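/- Let $n\ge p\ge 1$, let $M^n$ be a connected closed smooth $n$-manifold, and let $f\colon M^n\to\mathbb R^p$ be a special generic map, i.e. a smooth map such that around every singular point $x$ of $f$ (a point where $df_x$ is not surjective) and around $f(x)$ there are smooth coordinates $x_1,\dots,x_n$ and $y_1,\dots,y_p$, centred at $x$ and $f(x)$, in which $y_i\circ f=x_i$ for $1\le i\le p-1$ and $y_p\circ f=\pm(x_p^2+\dots+x_n^2)$. Let $W_f=M/\!\sim_f$ with the quotient topology, where $x_1\sim_f x_2$ if $f(x_1)=f(x_2)=:y$ and $x_1,x_2$ lie in the same connected component of $f^{-1}(y)$. Let $q_f\colon M\to W_f$ be the quotient map and $\overline f\colon W_f\to\mathbb R^p$ the map with $f=\overline f\circ q_f$. Suppose that $f(M^n)=D^p=\{x\in\mathbb R^p : \|x\|\le 1\}$ and that $\overline f$ is injective. Then $M^n$ is a homotopy sphere (it is homotopy equivalent to $S^n$) and $f$ is standard. The latter means that $p<n$ and that $W_f$ is diffeomorphic to $D^p$; here $W_f$ carries its structure of a smooth $p$-manifold with boundary for which $q_f$ is smooth, $q_f^{-1}(\partial W_f)$ is the set of singular points of $f$, and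 $\overline f$ is an immersion (such a structure exists, and $W_f$ with any such structure is diffeomorphic to $D^p$). -/

import Mathlib

open scoped Manifold ContDiff Topology ContinuousMap

noncomputable section

/-! ### The closed unit ball as a smooth manifold with boundary

For `v = e₀` the inversion `x ↦ 2 (x + v) / ‖x + v‖² - v` about the point `-v` is an involution of
`ℝᵖ ∖ {-v}` that exchanges the closed unit ball minus the point `-v` and the closed half-space
`{y | 0 ≤ y₀}`. It is one chart of the closed ball; its composition with `x ↦ -x` is the other one.
Both charts are restrictions of diffeomorphisms between open subsets of `ℝᵖ`, so that this is the
usual smooth structure of the closed ball as a codimension zero submanifold with boundary. -/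

namespace ClosedDisk

variable {p : ℕ} [NeZero p]

/-- The first vector of the standard basis. -/
def pole (p : ℕ) [NeZero p] : EuclideanSpace ℝ (Fin p) := EuclideanSpace.single 0 1

/-- Inversion about `-e₀` in the sphere of radius `√2`. -/
def cayley (x : EuclideanSpace ℝ (Fin p)) : EuclideanSpace ℝ (Fin p) :=
  (2 / ‖x + pole p‖ ^ 2) • (x + pole p) - pole p

theorem norm_add_pole_sq (x : EuclideanSpace ℝ (Fin p)) :
    ‖x + pole p‖ ^ 2 = ‖x‖ ^ 2 + 2 * x 0 + 1 := by
  rw [norm_add_sq_real]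
  simp [pole, EuclideanSpace.inner_single_right]

theorem cayley_apply_zero (x : EuclideanSpace ℝ (Fin p)) (hx : x + pole p ≠ 0) :
    cayley x 0 = (1 - ‖x‖ ^ 2) / ‖x + pole p‖ ^ 2 := by
  have h : ‖x + pole p‖ ^ 2 ≠ 0 := by simpa using hx
  have h1 : cayley x 0 = 2 / ‖x + pole p‖ ^ 2 * (x 0 + 1) - 1 := by
    simp [cayley, pole, mul_add]
  rw [h1, eq_div_iff h, sub_mul, mul_right_comm, div_mul_cancel₀ _ h, norm_add_pole_sq]
  ring

theorem cayley_add_pole (x : EuclideanSpace ℝ (Fin p)) :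
    cayley x + pole p = (2 / ‖x + pole p‖ ^ 2) • (x + pole p) := by
  simp [cayley]

theorem cayley_add_pole_ne (x : EuclideanSpace ℝ (Fin p)) (hx : x + pole p ≠ 0) :
    cayley x + pole p ≠ 0 := by
  have h : ‖x + pole p‖ ^ 2 ≠ 0 := by simpa using hx
  rw [cayley_add_pole]
  exact smul_ne_zero (div_ne_zero two_ne_zero h) hx

theorem cayley_cayley (x : EuclideanSpace ℝ (Fin p)) (hx : x + pole p ≠ 0) :
    cayley (cayley x) = x := by
  have h : ‖x + pole p‖ ≠ 0 := by simpa using hx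
  have h2 : ‖cayley x + pole p‖ ^ 2 = 4 / ‖x + pole p‖ ^ 2 := by
    rw [cayley_add_pole, norm_smul, mul_pow, Real.norm_eq_abs, sq_abs]
    field_simp
    norm_num
  rw [cayley, h2, cayley_add_pole, smul_smul]
  have h3 : 2 / (4 / ‖x + pole p‖ ^ 2) * (2 / ‖x + pole p‖ ^ 2) = 1 := by
    field_simp
    norm_num
  rw [h3, one_smul, add_sub_cancel_right]

theorem add_pole_ne_of_nonneg (y : EuclideanSpace ℝ (Fin p)) (hy : 0 ≤ y 0) :
    y + pole p ≠ 0 := by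
  intro h
  have := norm_add_pole_sq y
  rw [h] at this
  simp only [norm_zero] at this
  nlinarith [sq_nonneg ‖y‖]

theorem norm_cayley_le_one (y : EuclideanSpace ℝ (Fin p)) (hy : 0 ≤ y 0) : ‖cayley y‖ ≤ 1 := by
  have h0 := add_pole_ne_of_nonneg y hy
  have h1 := cayley_apply_zero _ (cayley_add_pole_ne y h0)
  rw [cayley_cayley y h0] at h1
  have h2 : 0 < ‖cayley y + pole p‖ ^ 2 := by
    have := norm_pos_iff.2 (cayley_add_pole_ne y h0)
    positivity
  by_contra! h3
  have h4 : (1 - ‖cayley y‖ ^ 2) / ‖cayley y + pole p‖ ^ 2 < 0 :=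
    div_neg_of_neg_of_pos (by nlinarith) h2
  linarith

theorem cayley_nonneg (x : EuclideanSpace ℝ (Fin p)) (hx : ‖x‖ ≤ 1) : 0 ≤ cayley x 0 ∨
    x + pole p = 0 := by
  by_cases h : x + pole p = 0
  · exact Or.inr h
  · left
    rw [cayley_apply_zero x h]
    have : 0 ≤ 1 - ‖x‖ ^ 2 := by nlinarith [norm_nonneg x]
    positivity

theorem contDiffOn_cayley :
    ContDiffOn ℝ ∞ (cayley (p := p)) {x | x + pole p ≠ 0} := by
  have h : ContDiff ℝ ∞ (fun x : EuclideanSpace ℝ (Fin p) => x + pole p) :=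
    contDiff_id.add contDiff_const
  have h1 : ContDiffOn ℝ ∞ (fun x : EuclideanSpace ℝ (Fin p) => 2 / ‖x + pole p‖ ^ 2)
      {x | x + pole p ≠ 0} := by
    refine ContDiffOn.div contDiffOn_const (h.norm_sq ℝ).contDiffOn ?_
    intro x hx
    simpa using hx
  exact (h1.smul h.contDiffOn).sub contDiffOn_const

open Classical in
/-- The chart of the closed unit ball given by inversion, defined away from `-e₀`. -/
def chartPos (p : ℕ) [NeZero p] :
    OpenPartialHomeomorph (Metric.closedBall (0 : EuclideanSpace ℝ (Fin p)) 1)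
      (EuclideanHalfSpace p) where
  toFun x := if h : 0 ≤ cayley (x : EuclideanSpace ℝ (Fin p)) 0 then ⟨cayley x, h⟩ else 0
  invFun y := ⟨cayley y.1, mem_closedBall_zero_iff.2 (norm_cayley_le_one y.1 y.2)⟩
  source := {x | (x : EuclideanSpace ℝ (Fin p)) + pole p ≠ 0}
  target := Set.univ
  map_source' _ _ := Set.mem_univ _
  map_target' y _ := cayley_add_pole_ne _ (add_pole_ne_of_nonneg y.1 y.2)
  left_inv' x hx := by
    have h : 0 ≤ cayley (x : EuclideanSpace ℝ (Fin p)) 0 :=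
      (cayley_nonneg x.1 (mem_closedBall_zero_iff.1 x.2)).resolve_right hx
    apply Subtype.ext
    simp only [h, dite_true]
    exact cayley_cayley _ hx
  right_inv' y _ := by
    have h := cayley_cayley _ (add_pole_ne_of_nonneg y.1 y.2)
    have h0 : 0 ≤ cayley (cayley y.1) 0 := by rw [h]; exact y.2
    simp only [h0, dite_true]
    exact Subtype.ext h
  open_source := isOpen_ne_fun (by fun_prop) continuous_const
  open_target := isOpen_univ
  continuousOn_toFun := by
    refine (Topology.IsInducing.subtypeVal (t := {y : EuclideanSpace ℝ (Fin p) |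
      0 ≤ y 0})).continuousOn_iff.2 ?_
    have h : ContinuousOn
        (fun x : Metric.closedBall (0 : EuclideanSpace ℝ (Fin p)) 1 => cayley x.1)
        {x | (x : EuclideanSpace ℝ (Fin p)) + pole p ≠ 0} :=
      contDiffOn_cayley.continuousOn.comp continuous_subtype_val.continuousOn fun _ hx => hx
    refine h.congr fun x hx => ?_
    have h : 0 ≤ cayley (x : EuclideanSpace ℝ (Fin p)) 0 :=
      (cayley_nonneg x.1 (mem_closedBall_zero_iff.1 x.2)).resolve_right hx
    simp [h]
  continuousOn_invFun := by
    rw [Topology.IsInducing.subtypeVal.continuousOn_iff]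
    exact contDiffOn_cayley.continuousOn.comp continuous_subtype_val.continuousOn
      fun y _ => add_pole_ne_of_nonneg y.1 y.2

/-- The antipodal map of the closed unit ball. -/
def antipode (p : ℕ) : Metric.closedBall (0 : EuclideanSpace ℝ (Fin p)) 1 ≃ₜ
    Metric.closedBall (0 : EuclideanSpace ℝ (Fin p)) 1 where
  toFun x := ⟨-x.1, by simp [mem_closedBall_zero_iff.1 x.2]⟩
  invFun x := ⟨-x.1, by simp [mem_closedBall_zero_iff.1 x.2]⟩
  left_inv x := by simp
  right_inv x := by simp

/-- The second chart of the closed unit ball, defined away from `e₀`. -/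
def chartNeg (p : ℕ) [NeZero p] :
    OpenPartialHomeomorph (Metric.closedBall (0 : EuclideanSpace ℝ (Fin p)) 1)
      (EuclideanHalfSpace p) :=
  (antipode p).toOpenPartialHomeomorph.trans (chartPos p)

theorem mem_chartNeg_source (x : Metric.closedBall (0 : EuclideanSpace ℝ (Fin p)) 1)
    (hx : x ∉ (chartPos p).source) : x ∈ (chartNeg p).source := by
  have h : (x : EuclideanSpace ℝ (Fin p)) + pole p = 0 := by
    simpa [chartPos] using hx
  have h1 : -(x : EuclideanSpace ℝ (Fin p)) + pole p ≠ 0 := by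
    rw [eq_neg_of_add_eq_zero_left h, neg_neg]
    exact add_pole_ne_of_nonneg _ (by simp [pole])
  simpa [chartNeg, chartPos, antipode] using h1

open Classical in
instance : ChartedSpace (EuclideanHalfSpace p)
    (Metric.closedBall (0 : EuclideanSpace ℝ (Fin p)) 1) where
  atlas := {chartPos p, chartNeg p}
  chartAt x := if x ∈ (chartPos p).source then chartPos p else chartNeg p
  mem_chart_source x := by
    by_cases h : x ∈ (chartPos p).source
    · simp [h]
    · simpa [h] using mem_chartNeg_source x h
  chart_mem_atlas x := by
    by_cases h : x ∈ (chartPos p).source <;> simp [h]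

theorem chartPos_apply (x : Metric.closedBall (0 : EuclideanSpace ℝ (Fin p)) 1)
    (hx : (x : EuclideanSpace ℝ (Fin p)) + pole p ≠ 0) :
    (chartPos p x).1 = cayley x.1 := by
  have h : 0 ≤ cayley (x : EuclideanSpace ℝ (Fin p)) 0 :=
    (cayley_nonneg x.1 (mem_closedBall_zero_iff.1 x.2)).resolve_right hx
  simp [chartPos, h]

/-- Both transition maps between the two charts are given by `y ↦ cayley (-cayley y)`. -/
theorem contDiffOn_transition :
    ContDiffOn ℝ ∞ (fun y : EuclideanSpace ℝ (Fin p) => cayley (-cayley y))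
      {y | 0 ≤ y 0 ∧ -cayley y + pole p ≠ 0} :=
  contDiffOn_cayley.comp
    ((contDiffOn_cayley.mono fun y hy => add_pole_ne_of_nonneg y hy.1).neg) fun _ hy => hy.2

instance : IsManifold (𝓡∂ p) ∞ (Metric.closedBall (0 : EuclideanSpace ℝ (Fin p)) 1) := by
  refine isManifold_of_contDiffOn _ _ _ ?_
  rintro e e' he he'
  have hself : ∀ f : OpenPartialHomeomorph (Metric.closedBall (0 : EuclideanSpace ℝ (Fin p)) 1)
      (EuclideanHalfSpace p), ContDiffOn ℝ ∞ ((𝓡∂ p) ∘ (f.symm.trans f) ∘ (𝓡∂ p).symm)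
      ((𝓡∂ p).symm ⁻¹' (f.symm.trans f).source ∩ Set.range (𝓡∂ p)) := fun f => by
    have := symm_trans_mem_contDiffGroupoid (n := ∞) (I := 𝓡∂ p) f
    rw [contDiffGroupoid, mem_groupoid_of_pregroupoid] at this
    exact this.1
  rcases he with rfl | rfl <;> rcases he' with rfl | rfl
  · exact hself _
  · refine contDiffOn_transition.congr_mono ?_ ?_
    · rintro y ⟨hy, z, rfl⟩
      have hz : (𝓡∂ p).symm ((𝓡∂ p) z) = z := (𝓡∂ p).left_inv z
      simp only [Set.mem_preimage, hz] at hy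
      simp only [Function.comp_apply, hz]
      exact chartPos_apply _ hy.2.2
    · rintro y ⟨hy, z, rfl⟩
      have hz : (𝓡∂ p).symm ((𝓡∂ p) z) = z := (𝓡∂ p).left_inv z
      simp only [Set.mem_preimage, hz] at hy
      exact ⟨z.2, hy.2.2⟩
  · refine contDiffOn_transition.congr_mono ?_ ?_
    · rintro y ⟨hy, z, rfl⟩
      have hz : (𝓡∂ p).symm ((𝓡∂ p) z) = z := (𝓡∂ p).left_inv z
      simp only [Set.mem_preimage, hz] at hy
      simp only [Function.comp_apply, hz]
      exact chartPos_apply _ hy.2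
    · rintro y ⟨hy, z, rfl⟩
      have hz : (𝓡∂ p).symm ((𝓡∂ p) z) = z := (𝓡∂ p).left_inv z
      simp only [Set.mem_preimage, hz] at hy
      exact ⟨z.2, hy.2⟩
  · exact hself _

end ClosedDisk

/-! ### Special generic maps -/

/-- The singular locus: the points where the differential is not surjective. It is used for maps
with `p ≤ n` only. -/
def singularLocus (n : ℕ) {p : ℕ} {M : Type*} [TopologicalSpace M]
    [ChartedSpace (EuclideanSpace ℝ (Fin n)) M]
    (f : M → EuclideanSpace ℝ (Fin p)) : Set M :=
  {x | ¬ Function.Surjective (mfderiv (𝓡 n) (𝓡 p) f x)}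

/-- `x` is a fold point of `f` with exactly `l` positive squares: in suitable smooth coordinates
`x₁, …, xₙ` centred at `x` and `y₁, …, yₚ` centred at `f x`, the map `f` has the form `yᵢ = xᵢ` for
`i < p` and `yₚ = xₚ² + ⋯ + xₚ₊ₗ₋₁² - xₚ₊ₗ² - ⋯ - xₙ²`. The coordinate `xₖ` is the component of
index `k - 1`. -/
def IsFoldPoint (n : ℕ) {p : ℕ} {M : Type*} [TopologicalSpace M]
    [ChartedSpace (EuclideanSpace ℝ (Fin n)) M]
    (f : M → EuclideanSpace ℝ (Fin p)) (x : M) (l : ℕ) : Prop :=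
  ∃ φ ∈ IsManifold.maximalAtlas (𝓡 n) ∞ M,
  ∃ ψ ∈ IsManifold.maximalAtlas (𝓡 p) ∞ (EuclideanSpace ℝ (Fin p)),
    x ∈ φ.source ∧ φ x = 0 ∧ ψ (f x) = 0 ∧ φ.source ⊆ f ⁻¹' ψ.source ∧
    ∀ z ∈ φ.source,
      (∀ (i : Fin n) (j : Fin p), (i : ℕ) = j → (j : ℕ) + 1 < p → ψ (f z) j = φ z i) ∧
      (∀ j : Fin p, (j : ℕ) + 1 = p →
        ψ (f z) j = ∑ i : Fin n,
          if (i : ℕ) + 1 < p then 0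
          else if (i : ℕ) + 1 < p + l then (φ z i) ^ 2
          else -(φ z i) ^ 2)

/-- A definite fold point: a fold point of absolute index `max l (n - p + 1 - l) = n - p + 1`. -/
def IsDefiniteFoldPoint (n : ℕ) {p : ℕ} {M : Type*} [TopologicalSpace M]
    [ChartedSpace (EuclideanSpace ℝ (Fin n)) M]
    (f : M → EuclideanSpace ℝ (Fin p)) (x : M) : Prop :=
  ∃ l ≤ n + 1 - p, max l (n + 1 - p - l) = n + 1 - p ∧ IsFoldPoint n f x l

/-- A special generic map is a smooth map, from dimension `n` to dimension `p ≤ n` with `1 ≤ p`, all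
of whose singular points are definite fold points. -/
def IsSpecialGeneric (n : ℕ) {p : ℕ} {M : Type*} [TopologicalSpace M]
    [ChartedSpace (EuclideanSpace ℝ (Fin n)) M]
    (f : M → EuclideanSpace ℝ (Fin p)) : Prop :=
  1 ≤ p ∧ p ≤ n ∧ ContMDiff (𝓡 n) (𝓡 p) ∞ f ∧ ∀ x ∈ singularLocus n f, IsDefiniteFoldPoint n f x

/-! ### Stein factorization -/

section Stein

variable {X Y : Type*} [TopologicalSpace X]

/-- Two points are equivalent if they have the same image `y` and lie in the same connected
component of the fibre over `y`. -/
def steinSetoid (f : X → Y) : Setoid X where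
  r x₁ x₂ := f x₁ = f x₂ ∧ x₂ ∈ connectedComponentIn (f ⁻¹' {f x₁}) x₁
  iseqv :=
    { refl := fun _ => ⟨rfl, mem_connectedComponentIn rfl⟩
      symm := fun {x₁ x₂} h => by
        refine ⟨h.1.symm, ?_⟩
        rw [← h.1, ← connectedComponentIn_eq h.2]
        exact mem_connectedComponentIn rfl
      trans := fun {x₁ x₂ x₃} h h' => by
        refine ⟨h.1.trans h'.1, ?_⟩
        rw [connectedComponentIn_eq h.2, h.1]
        exact h'.2 }

/-- The space `W_f` of the Stein factorization, with the quotient topology. -/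
abbrev SteinSpace (f : X → Y) : Type _ := Quotient (steinSetoid f)

/-- The quotient map `q_f`. -/
def steinProj (f : X → Y) : X → SteinSpace f := Quotient.mk (steinSetoid f)

/-- The induced map on the Stein factorization, with `steinMap f ∘ steinProj f = f`. -/
def steinMap (f : X → Y) : SteinSpace f → Y := Quotient.lift f fun _ _ h => h.1

end Stein

/-! ### Standard special generic maps on homotopy spheres -/

/-- A closed smooth `n`-manifold is a homotopy sphere if it is homotopy equivalent to `Sⁿ`. -/
def IsHomotopySphere (n : ℕ) (M : Type*) [TopologicalSpace M]
    [ChartedSpace (EuclideanSpace ℝ (Fin n)) M] : Prop :=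
  IsManifold (𝓡 n) ∞ M ∧ T2Space M ∧ CompactSpace M ∧
    Nonempty (M ≃ₕ Metric.sphere (0 : EuclideanSpace ℝ (Fin (n + 1))) 1)

/-- The charts `cs` make `W_f`, with its quotient topology, a smooth `p`-manifold with boundary
such that `q_f` is smooth, the preimage of the boundary under `q_f` is the singular locus of `f`,
and the induced map from `W_f` to `ℝᵖ` is an immersion. For a special generic map with `p < n` this
is the smooth structure carried by the Stein factorization; it is unique because the induced map is
an immersion between manifolds of the same dimension. -/
structure IsSteinStructure (n : ℕ) {p : ℕ} [NeZero p] {M : Type*} [TopologicalSpace M]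
    [ChartedSpace (EuclideanSpace ℝ (Fin n)) M]
    (f : M → EuclideanSpace ℝ (Fin p))
    (cs : ChartedSpace (EuclideanHalfSpace p) (SteinSpace f)) : Prop where
  isManifold : IsManifold (𝓡∂ p) ∞ (SteinSpace f)
  t2 : T2Space (SteinSpace f)
  secondCountable : SecondCountableTopology (SteinSpace f)
  smooth_proj : ContMDiff (𝓡 n) (𝓡∂ p) ∞ (steinProj f)
  preimage_boundary :
    steinProj f ⁻¹' (𝓡∂ p).boundary (SteinSpace f) = singularLocus n f
  immersion_map : Manifold.IsImmersion (𝓡∂ p) (𝓡 p) ∞ (steinMap f)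

/-- A special generic map with `p < n` on a homotopy sphere is standard if its Stein factorization
`W_f`, as a smooth manifold with boundary, is diffeomorphic to the closed unit ball: the smooth
structure on `W_f` exists, and `W_f` with this structure is diffeomorphic to the ball. -/
def IsStandard (n : ℕ) {p : ℕ} [NeZero p] {M : Type*} [TopologicalSpace M]
    [ChartedSpace (EuclideanSpace ℝ (Fin n)) M]
    (f : M → EuclideanSpace ℝ (Fin p)) : Prop :=
  IsHomotopySphere n M ∧ IsSpecialGeneric n f ∧ p < n ∧
  (∃ cs : ChartedSpace (EuclideanHalfSpace p) (SteinSpace f), IsSteinStructure n f cs) ∧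
  ∀ cs : ChartedSpace (EuclideanHalfSpace p) (SteinSpace f), IsSteinStructure n f cs →
    Nonempty (Diffeomorph (𝓡∂ p) (𝓡∂ p) (SteinSpace f)
      (Metric.closedBall (0 : EuclideanSpace ℝ (Fin p)) 1) ∞)

end

/-!
Connected fibres force a singular point to be alone in its fibre, since a definite fold chart
isolates it there; hence the fold side is the whole image near a singular value, and the singular
points are exactly the points lying over the unit sphere. Fix such a point and let `b` be its image.
The height function `⟪b, f⟫` can only be critical at a singular point whose value is normal to the
sphere in the direction `±b`, so it has exactly two critical points, its maximum and its minimum.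

In fold coordinates the height is strictly monotone along the rays leaving each extremum. In place
of a gradient flow, homeomorphisms supported in charts are composed to one that raises the height
strictly away from the two extrema and is a linear contraction near the maximum. The complement of
the minimum is then the basin of attraction of the maximum, hence a copy of `ℝⁿ`, and its one-point
compactification `M` is the sphere.

Finally, the injective map `f̄` from the compact space `W_f` is a homeomorphism onto the closed
ball. Transporting the structure of the ball makes `f̄` an immersion, and any two structures for
which `f̄` is an immersion agree, because smoothness into `W_f` can be tested after composing with
`f̄`.
-/

/-! ### Extending homeomorphisms of a chart by the identity -/

section ExtendById

variable {M E : Type*} [TopologicalSpace M] [TopologicalSpace E]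

open Classical in
/-- The self-map of `M` that reads `h` in the chart `φ` and is the identity off the chart domain. -/
noncomputable def extendById (φ : OpenPartialHomeomorph M E) (h : E → E) (x : M) : M :=
  if x ∈ φ.source then φ.symm (h (φ x)) else x

variable {φ : OpenPartialHomeomorph M E} {h h' : E → E} {K : Set E} {x : M}

theorem extendById_of_mem (hx : x ∈ φ.source) : extendById φ h x = φ.symm (h (φ x)) :=
  if_pos hx

theorem extendById_of_notMem (hx : x ∉ φ.source) : extendById φ h x = x :=
  if_neg hx

theorem extendById_symm_apply {y : E} (hy : y ∈ φ.target) :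
    extendById φ h (φ.symm y) = φ.symm (h y) := by
  rw [extendById_of_mem (φ.map_target hy), φ.right_inv hy]

theorem extendById_eq_self (hid : ∀ y ∉ K, h y = y) (hx : x ∉ φ.symm '' K) :
    extendById φ h x = x := by
  by_cases hs : x ∈ φ.source
  · rw [extendById_of_mem hs, hid, φ.left_inv hs]
    exact fun hy => hx ⟨_, hy, φ.left_inv hs⟩
  · exact extendById_of_notMem hs

theorem mapsTo_of_forall_notMem_eq_self {α : Type*} {f : α → α} {s t : Set α}
    (hf : Function.Injective f) (hst : s ⊆ t) (hid : ∀ y ∉ s, f y = y) : Set.MapsTo f t t := by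
  intro y hy
  by_cases hfy : f y ∈ s
  · exact hst hfy
  · rwa [hf (hid _ hfy)]

theorem leftInverse_extendById (hh : Set.MapsTo h φ.target φ.target)
    (hinv : Function.LeftInverse h' h) :
    Function.LeftInverse (extendById φ h') (extendById φ h) := by
  intro x
  by_cases hs : x ∈ φ.source
  · rw [extendById_of_mem hs, extendById_symm_apply (hh (φ.map_source hs)), hinv, φ.left_inv hs]
  · rw [extendById_of_notMem (h := h) hs, extendById_of_notMem hs]

theorem continuous_extendById [T2Space M] (hcont : Continuous h)
    (hh : Set.MapsTo h φ.target φ.target) (hKc : IsCompact K) (hK : K ⊆ φ.target)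
    (hid : ∀ y ∉ K, h y = y) : Continuous (extendById φ h) := by
  rw [continuous_iff_continuousAt]
  intro x
  by_cases hx : x ∈ φ.source
  · have hchart : ContinuousAt (fun z => φ.symm (h (φ z))) x :=
      (φ.continuousAt_symm (hh (φ.map_source hx))).tendsto.comp
        (hcont.continuousAt.tendsto.comp (φ.continuousAt hx))
    refine hchart.congr ?_
    filter_upwards [φ.open_source.mem_nhds hx] with z hz using (extendById_of_mem hz).symm
  · have hclosed : IsClosed (φ.symm '' K) :=
      (hKc.image_of_continuousOn (φ.continuousOn_symm.mono hK)).isClosed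
    have hxK : x ∉ φ.symm '' K := by
      rintro ⟨y, hy, rfl⟩
      exact hx (φ.map_target (hK hy))
    refine continuousAt_id.congr ?_
    filter_upwards [hclosed.isOpen_compl.mem_nhds hxK] with z hz using
      (extendById_eq_self hid hz).symm

theorem exists_homeomorph_eq_extendById [T2Space M] (φ : OpenPartialHomeomorph M E) (h : E ≃ₜ E)
    (hKc : IsCompact K) (hK : K ⊆ φ.target) (hid : ∀ y ∉ K, h y = y) :
    ∃ Ψ : M ≃ₜ M, ⇑Ψ = extendById φ h := by
  have hid_symm : ∀ y ∉ K, h.symm y = y := fun y hy => by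
    rw [Homeomorph.symm_apply_eq, hid y hy]
  have hmaps := mapsTo_of_forall_notMem_eq_self h.injective hK hid
  have hmaps_symm := mapsTo_of_forall_notMem_eq_self h.symm.injective hK hid_symm
  exact ⟨
    { toFun := extendById φ h
      invFun := extendById φ h.symm
      left_inv := leftInverse_extendById hmaps h.left_inv
      right_inv := leftInverse_extendById hmaps_symm h.right_inv
      continuous_toFun := continuous_extendById h.continuous hmaps hKc hK hid
      continuous_invFun := continuous_extendById h.symm.continuous hmaps_symm hKc hK hid_symm },
    rfl⟩

end ExtendById

/-! ### Small perturbations of the identity -/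

section Perturbation

variable {E : Type*} [NormedAddCommGroup E] [NormedSpace ℝ E] [CompleteSpace E] {W : E → E}

theorem exists_homeomorph_id_add_of_lipschitzWith {c : NNReal} (hW : LipschitzWith c W)
    (hc : c < 1) : ∃ h : E ≃ₜ E, ∀ x, h x = x + W x := by
  have happrox : ApproximatesLinearOn (fun x => x + W x)
      (ContinuousLinearEquiv.refl ℝ E : E →L[ℝ] E) Set.univ c := by
    intro x _ y _
    have hdiff : x + W x - (y + W y) - (x - y) = W x - W y := by abel
    simpa only [ContinuousLinearEquiv.coe_refl, ContinuousLinearMap.id_apply, hdiff]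
      using hW.norm_sub_le x y
  have hconst : Subsingleton E ∨
      c < ‖((ContinuousLinearEquiv.refl ℝ E).symm : E →L[ℝ] E)‖₊⁻¹ := by
    rcases subsingleton_or_nontrivial E with hE | hE
    · exact Or.inl hE
    · right
      rwa [ContinuousLinearEquiv.refl_symm, ContinuousLinearEquiv.coe_refl,
        ContinuousLinearMap.nnnorm_id, inv_one]
  exact ⟨happrox.toHomeomorph _ hconst, fun x => rfl⟩

theorem exists_homeomorph_add_smul (hW : ContDiff ℝ 1 W) (hc : HasCompactSupport W) {δ : ℝ}
    (hδ : 0 < δ) : ∃ ε ∈ Set.Ioo 0 δ, ∃ h : E ≃ₜ E, ∀ x, h x = x + ε • W x := by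
  obtain ⟨C, hC⟩ := hW.lipschitzWith_of_hasCompactSupport hc one_ne_zero
  set ε : ℝ := min (δ / 2) (1 / (2 * (C + 1)))
  have hε_pos : 0 < ε := lt_min (by positivity) (by positivity)
  have hε_lt : ε < δ := (min_le_left _ _).trans_lt (by linarith)
  have hεC : ε * C < 1 := by
    calc ε * C ≤ 1 / (2 * (C + 1)) * C := by gcongr; exact min_le_right _ _
      _ = C / (2 * (C + 1)) := by ring
      _ < 1 := by rw [div_lt_one (by positivity)]; linarith [C.2]
  have hlip : LipschitzWith (‖ε‖₊ * C) (fun x => ε • W x) := (lipschitzWith_smul ε).comp hC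
  refine ⟨ε, ⟨hε_pos, hε_lt⟩, exists_homeomorph_id_add_of_lipschitzWith hlip ?_⟩
  rwa [← NNReal.coe_lt_coe, NNReal.coe_mul, coe_nnnorm, NNReal.coe_one,
    Real.norm_of_nonneg hε_pos.le]

end Perturbation

/-! ### Homeomorphisms that increase a function -/

section Increasing

/-- Every point is fixed by `Ψ` or moved to a point at which `g` is larger. The increasing
homeomorphisms play the role of the flow of a gradient-like vector field. -/
def IsIncreasingFor {M : Type*} (g : M → ℝ) (Ψ : M → M) : Prop :=
  ∀ x, Ψ x = x ∨ g x < g (Ψ x)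

namespace IsIncreasingFor

variable {M : Type*} {g : M → ℝ} {Ψ Ψ' : M → M}

theorem le_apply (h : IsIncreasingFor g Ψ) (x : M) : g x ≤ g (Ψ x) := by
  rcases h x with hfix | hlt
  · rw [hfix]
  · exact hlt.le

theorem comp (h' : IsIncreasingFor g Ψ') (h : IsIncreasingFor g Ψ) :
    IsIncreasingFor g (Ψ' ∘ Ψ) := fun x => by
  rcases h x with hfix | hlt
  · simpa only [Function.comp_apply, hfix] using h' x
  · exact Or.inr (hlt.trans_le (h'.le_apply _))

theorem comp_eq_self (h' : IsIncreasingFor g Ψ') (h : IsIncreasingFor g Ψ) {x : M}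
    (hx : Ψ' (Ψ x) = x) : Ψ x = x ∧ Ψ' x = x := by
  have hfix : Ψ x = x := (h x).resolve_right fun hlt =>
    (hlt.trans_le (h'.le_apply (Ψ x))).ne (by rw [hx])
  exact ⟨hfix, by rwa [hfix] at hx⟩

theorem symm_of_neg [TopologicalSpace M] {Ψ : M ≃ₜ M} (h : IsIncreasingFor (-g) Ψ) :
    IsIncreasingFor g Ψ.symm := fun x => by
  simpa only [Pi.neg_apply, Ψ.apply_symm_apply, neg_lt_neg_iff, eq_comm] using h (Ψ.symm x)

end IsIncreasingFor

variable {M E : Type*} [TopologicalSpace M] [T2Space M] [NormedAddCommGroup E]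
  [NormedSpace ℝ E] [CompleteSpace E]

theorem exists_homeomorph_isIncreasingFor (φ : OpenPartialHomeomorph M E) {W : E → E}
    (hW : ContDiff ℝ 1 W) (hc : HasCompactSupport W) (hsub : tsupport W ⊆ φ.target) {δ : ℝ}
    (hδ : 0 < δ) {g : M → ℝ}
    (hg : ∀ y, W y ≠ 0 → ∀ t ∈ Set.Ioo 0 δ, g (φ.symm y) < g (φ.symm (y + t • W y))) :
    ∃ ε ∈ Set.Ioo 0 δ, ∃ Ψ : M ≃ₜ M, IsIncreasingFor g Ψ ∧
      (∀ x ∉ φ.symm '' tsupport W, Ψ x = x) ∧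
      ∀ y ∈ φ.target, Ψ (φ.symm y) = φ.symm (y + ε • W y) := by
  obtain ⟨ε, hε, h, hh⟩ := exists_homeomorph_add_smul hW hc hδ
  have hid : ∀ y ∉ tsupport W, h y = y := fun y hy => by
    rw [hh, image_eq_zero_of_notMem_tsupport hy, smul_zero, add_zero]
  obtain ⟨Ψ, hΨ⟩ := exists_homeomorph_eq_extendById φ h hc hsub hid
  have happly : ∀ y ∈ φ.target, Ψ (φ.symm y) = φ.symm (y + ε • W y) := fun y hy => by
    rw [hΨ, extendById_symm_apply hy, hh]
  have hfix : ∀ x ∉ φ.symm '' tsupport W, Ψ x = x := fun x hx => by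
    rw [hΨ, extendById_eq_self hid hx]
  refine ⟨ε, hε, Ψ, fun x => ?_, hfix, happly⟩
  by_cases hx : x ∈ φ.symm '' tsupport W
  · obtain ⟨y, hy, rfl⟩ := hx
    rw [happly y (hsub hy)]
    by_cases hWy : W y = 0
    · left
      rw [hWy, smul_zero, add_zero]
    · exact Or.inr (hg y hWy ε hε)
  · exact Or.inl (hfix x hx)

end Increasing

theorem IsIncreasingFor.exists_fixed_mapClusterPt {M : Type*} [TopologicalSpace M] [CompactSpace M]
    {g : M → ℝ} (hg : Continuous g) {Φ : M → M} (hΦc : Continuous Φ) (hΦ : IsIncreasingFor g Φ)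
    (x : M) :
    ∃ y, Φ y = y ∧ g x ≤ g y ∧ MapClusterPt y Filter.atTop (fun k => Φ^[k] x) := by
  have hmono : Monotone fun k => g (Φ^[k] x) := monotone_nat_of_le_succ fun k => by
    rw [Function.iterate_succ_apply']
    exact hΦ.le_apply _
  have hbdd : BddAbove (Set.range fun k => g (Φ^[k] x)) :=
    (isCompact_range hg).bddAbove.mono (Set.range_comp_subset_range _ _)
  have hlim := tendsto_atTop_ciSup hmono hbdd
  set L := ⨆ k, g (Φ^[k] x)
  obtain ⟨y, hy⟩ : ∃ y, MapClusterPt y Filter.atTop (fun k => Φ^[k] x) :=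
    exists_clusterPt_of_compactSpace _
  have heq_of_tendsto : ∀ G : M → ℝ, Continuous G →
      Filter.Tendsto (fun k => G (Φ^[k] x)) Filter.atTop (𝓝 L) → G y = L := fun G hG hGL =>
    eq_of_nhds_neBot (ClusterPt.mono (hy.continuousAt_comp hG.continuousAt) hGL)
  have hgy : g y = L := heq_of_tendsto g hg hlim
  have hgΦy : g (Φ y) = L := heq_of_tendsto (g ∘ Φ) (hg.comp hΦc) <| by
    simpa only [Function.comp_def, Function.iterate_succ_apply'] using
      hlim.comp (Filter.tendsto_add_atTop_nat 1)
  refine ⟨y, (hΦ y).resolve_right (by rw [hgy, hgΦy]; exact lt_irrefl L), ?_, hy⟩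
  rw [hgy]
  exact hmono.ge_of_tendsto hlim 0

/-! ### The basin of attraction of a linear contraction -/

section Basin

variable {M E : Type*} [TopologicalSpace M] [NormedAddCommGroup E] [NormedSpace ℝ E]

/-- In the chart `φ`, the homeomorphism `Φ` is multiplication by `c ∈ (0, 1)` on the closed ball of
radius `R` about the origin. -/
structure IsLinearContraction (Φ : M ≃ₜ M) (φ : OpenPartialHomeomorph M E) (R c : ℝ) : Prop where
  radius_pos : 0 < R
  factor_pos : 0 < c
  factor_lt_one : c < 1
  closedBall_subset : Metric.closedBall 0 R ⊆ φ.target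
  apply_symm : ∀ y ∈ Metric.closedBall 0 R, Φ (φ.symm y) = φ.symm (c • y)

/-- The `k`-th approximation `v ↦ Φ⁻ᵏ (φ⁻¹ (cᵏ v))` of the parametrization of the basin; for a
linear contraction with factor `c` it no longer depends on `k` once `cᵏ v` lies in the ball. -/
noncomputable def basinStage (Φ : M ≃ₜ M) (φ : OpenPartialHomeomorph M E) (c : ℝ) (k : ℕ) (v : E) :
    M :=
  (Φ ^ k).symm (φ.symm (c ^ k • v))

/-- The parametrization of the basin of attraction of a linear contraction by the model space. -/
noncomputable def basinMap (Φ : M ≃ₜ M) (φ : OpenPartialHomeomorph M E) (R c : ℝ) (v : E) : M :=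
  basinStage Φ φ c (sInf {k | ‖c ^ k • v‖ < R}) v

namespace IsLinearContraction

variable {Φ : M ≃ₜ M} {φ : OpenPartialHomeomorph M E} {R c : ℝ}

theorem mono (h : IsLinearContraction Φ φ R c) {R' : ℝ} (hR' : 0 < R') (hle : R' ≤ R) :
    IsLinearContraction Φ φ R' c where
  radius_pos := hR'
  factor_pos := h.factor_pos
  factor_lt_one := h.factor_lt_one
  closedBall_subset := (Metric.closedBall_subset_closedBall hle).trans h.closedBall_subset
  apply_symm y hy := h.apply_symm y (Metric.closedBall_subset_closedBall hle hy)

theorem mem_target (h : IsLinearContraction Φ φ R c) {y : E} (hy : ‖y‖ ≤ R) : y ∈ φ.target :=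
  h.closedBall_subset (mem_closedBall_zero_iff.2 hy)

theorem norm_pow_smul_anti (h : IsLinearContraction Φ φ R c) (v : E) :
    Antitone fun k : ℕ => ‖c ^ k • v‖ := fun k m hkm => by
  have hc := h.factor_pos.le
  simp only [norm_smul, norm_pow, Real.norm_of_nonneg hc]
  gcongr ?_ * _
  exact pow_le_pow_of_le_one hc h.factor_lt_one.le hkm

theorem exists_norm_pow_smul_lt (h : IsLinearContraction Φ φ R c) (v : E) :
    ∃ k : ℕ, ‖c ^ k • v‖ < R := by
  have hlim : Filter.Tendsto (fun k : ℕ => ‖c ^ k • v‖) Filter.atTop (𝓝 ‖(0 : ℝ) • v‖) :=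
    ((tendsto_pow_atTop_nhds_zero_of_lt_one h.factor_pos.le h.factor_lt_one).smul_const v).norm
  rw [zero_smul, norm_zero] at hlim
  exact (hlim.eventually_lt_const h.radius_pos).exists

theorem eq_zero_of_apply_eq_self (h : IsLinearContraction Φ φ R c) {y : E} (hy : ‖y‖ ≤ R)
    (hfix : Φ (φ.symm y) = φ.symm y) : y = 0 := by
  have hcy : ‖c • y‖ ≤ R := by
    simpa only [pow_one, pow_zero, one_smul] using
      (h.norm_pow_smul_anti y zero_le_one).trans (by simpa only [pow_zero, one_smul] using hy)
  rw [h.apply_symm y (mem_closedBall_zero_iff.2 hy)] at hfix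
  have hcy_eq : c • y = y := φ.symm.injOn (h.mem_target hcy) (h.mem_target hy) hfix
  have hfactor : (1 - c) • y = 0 := by rw [sub_smul, one_smul, hcy_eq, sub_self]
  exact (smul_eq_zero.1 hfactor).resolve_left (sub_ne_zero.2 h.factor_lt_one.ne')

theorem apply_symm_zero (h : IsLinearContraction Φ φ R c) : Φ (φ.symm 0) = φ.symm 0 := by
  rw [h.apply_symm 0 (Metric.mem_closedBall_self h.radius_pos.le), smul_zero]

theorem symm_zero_mem_image_ball (h : IsLinearContraction Φ φ R c) :
    φ.symm 0 ∈ φ.symm '' Metric.ball 0 R :=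
  ⟨0, Metric.mem_ball_self h.radius_pos, rfl⟩

theorem isOpen_image_ball (h : IsLinearContraction Φ φ R c) :
    IsOpen (φ.symm '' Metric.ball 0 R) :=
  φ.symm.isOpen_image_of_subset_source Metric.isOpen_ball
    (Metric.ball_subset_closedBall.trans h.closedBall_subset)

theorem isClosed_image_closedBall [T2Space M] [FiniteDimensional ℝ E]
    (h : IsLinearContraction Φ φ R c) : IsClosed (φ.symm '' Metric.closedBall 0 R) :=
  have := FiniteDimensional.proper ℝ E
  ((isCompact_closedBall 0 R).image_of_continuousOn
    (φ.continuousOn_symm.mono h.closedBall_subset)).isClosed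

theorem notMem_image_closedBall (h : IsLinearContraction Φ φ R c) {x : M} (hx : Φ x = x)
    (hne : x ≠ φ.symm 0) : x ∉ φ.symm '' Metric.closedBall 0 R := by
  rintro ⟨y, hy, rfl⟩
  exact hne (by rw [h.eq_zero_of_apply_eq_self (mem_closedBall_zero_iff.1 hy) hx])

theorem notMem_image_ball (h : IsLinearContraction Φ φ R c) {x : M} (hx : Φ x = x)
    (hne : x ≠ φ.symm 0) : x ∉ φ.symm '' Metric.ball 0 R := fun hball =>
  h.notMem_image_closedBall hx hne (Set.image_mono Metric.ball_subset_closedBall hball)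

theorem basinStage_eq (h : IsLinearContraction Φ φ R c) {k m : ℕ} {v : E}
    (hk : ‖c ^ k • v‖ < R) (hkm : k ≤ m) : basinStage Φ φ c m v = basinStage Φ φ c k v := by
  induction m, hkm using Nat.le_induction with
  | base => rfl
  | succ m hkm ih =>
    have hm : c ^ m • v ∈ Metric.closedBall (0 : E) R :=
      mem_closedBall_zero_iff.2 ((h.norm_pow_smul_anti v hkm).trans hk.le)
    rw [← ih, basinStage, basinStage, Homeomorph.symm_apply_eq, pow_succ' Φ, Homeomorph.mul_apply,
      Homeomorph.apply_symm_apply, h.apply_symm _ hm, smul_smul, ← pow_succ']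

theorem basinMap_eq (h : IsLinearContraction Φ φ R c) {k : ℕ} {v : E} (hk : ‖c ^ k • v‖ < R) :
    basinMap Φ φ R c v = basinStage Φ φ c k v :=
  (h.basinStage_eq (Nat.sInf_mem (s := {k | ‖c ^ k • v‖ < R}) ⟨k, hk⟩) (Nat.sInf_le hk)).symm

theorem map_basinMap_nhds (h : IsLinearContraction Φ φ R c) (v : E) :
    Filter.map (basinMap Φ φ R c) (𝓝 v) = 𝓝 (basinMap Φ φ R c v) := by
  obtain ⟨k, hk⟩ := h.exists_norm_pow_smul_lt v
  have hnear : ∀ᶠ w in 𝓝 v, ‖c ^ k • w‖ < R :=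
    (show Continuous fun w : E => ‖c ^ k • w‖ by fun_prop).continuousAt.eventually_lt_const hk
  have hstage : basinMap Φ φ R c =ᶠ[𝓝 v] (Φ ^ k).symm ∘ φ.symm ∘ (c ^ k • ·) :=
    hnear.mono fun w hw => h.basinMap_eq hw
  have hsmul : Filter.map (c ^ k • ·) (𝓝 v) = 𝓝 (c ^ k • v) :=
    (Homeomorph.smulOfNeZero (c ^ k) (pow_pos h.factor_pos k).ne').map_nhds_eq v
  rw [Filter.map_congr hstage, hstage.eq_of_nhds, ← Filter.map_map, ← Filter.map_map, hsmul,
    φ.symm.map_nhds_eq (h.mem_target hk.le), Homeomorph.map_nhds_eq]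
  rfl

theorem basinMap_injective (h : IsLinearContraction Φ φ R c) :
    Function.Injective (basinMap Φ φ R c) := fun v w hvw => by
  obtain ⟨k, hk⟩ := h.exists_norm_pow_smul_lt v
  obtain ⟨l, hl⟩ := h.exists_norm_pow_smul_lt w
  have hv := (h.norm_pow_smul_anti v (le_max_left k l)).trans_lt hk
  have hw := (h.norm_pow_smul_anti w (le_max_right k l)).trans_lt hl
  rw [h.basinMap_eq hv, h.basinMap_eq hw] at hvw
  exact smul_right_injective E (pow_pos h.factor_pos _).ne' <|
    φ.symm.injOn (h.mem_target hv.le) (h.mem_target hw.le) ((Φ ^ max k l).symm.injective hvw)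

theorem isOpenEmbedding_basinMap (h : IsLinearContraction Φ φ R c) :
    Topology.IsOpenEmbedding (basinMap Φ φ R c) :=
  .of_continuous_injective_isOpenMap
    (continuous_iff_continuousAt.2 fun v => (h.map_basinMap_nhds v).le) h.basinMap_injective
    (IsOpenMap.of_nhds_le fun v => (h.map_basinMap_nhds v).ge)

theorem range_basinMap (h : IsLinearContraction Φ φ R c) :
    Set.range (basinMap Φ φ R c) = {x | ∃ k, Φ^[k] x ∈ φ.symm '' Metric.ball 0 R} := by
  have hpow (k : ℕ) : Φ^[k] = ⇑(Φ ^ k) := (hom_coe_pow _ rfl (fun _ _ => rfl) Φ k).symm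
  ext x
  constructor
  · rintro ⟨v, rfl⟩
    obtain ⟨k, hk⟩ := h.exists_norm_pow_smul_lt v
    refine ⟨k, c ^ k • v, mem_ball_zero_iff.2 hk, ?_⟩
    rw [h.basinMap_eq hk, hpow, basinStage, Homeomorph.apply_symm_apply]
  · rintro ⟨k, y, hy, hyx⟩
    have hck : c ^ k • (c ^ k)⁻¹ • y = y := smul_inv_smul₀ (pow_pos h.factor_pos k).ne' y
    refine ⟨(c ^ k)⁻¹ • y, ?_⟩
    rw [h.basinMap_eq (by rwa [hck, ← mem_ball_zero_iff]), basinStage, hck,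
      Homeomorph.symm_apply_eq, hyx, hpow]

theorem range_basinMap_eq_compl_singleton [CompactSpace M] (h : IsLinearContraction Φ φ R c)
    {g : M → ℝ} (hg : Continuous g) (hΦ : IsIncreasingFor g Φ) {xmin : M} (hxmin : Φ xmin = xmin)
    (hmin : ∀ x, x ≠ xmin → g xmin < g x) (hne : φ.symm 0 ≠ xmin)
    (hfix : ∀ x, Φ x = x → x = xmin ∨ x = φ.symm 0) :
    Set.range (basinMap Φ φ R c) = {xmin}ᶜ := by
  rw [h.range_basinMap]
  ext x
  constructor
  · rintro ⟨k, hk⟩ rfl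
    rw [Function.iterate_fixed hxmin] at hk
    exact h.notMem_image_ball hxmin hne.symm hk
  · intro hx
    obtain ⟨y, hy, hgxy, hcluster⟩ := hΦ.exists_fixed_mapClusterPt hg Φ.continuous x
    have hy_ne : y ≠ xmin := by
      rintro rfl
      exact (hmin x hx).not_ge hgxy
    obtain rfl := (hfix y hy).resolve_left hy_ne
    have hzero : (0 : E) ∈ φ.symm.source := h.mem_target (norm_zero.le.trans h.radius_pos.le)
    exact (hcluster.frequently (φ.symm.image_mem_nhds hzero
      (Metric.ball_mem_nhds 0 h.radius_pos))).exists

end IsLinearContraction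

theorem nonempty_homeomorph_sphere_of_isOpenEmbedding [CompactSpace M] [T2Space M] {n : ℕ} {x : M}
    {j : EuclideanSpace ℝ (Fin n) → M} (hj : Topology.IsOpenEmbedding j)
    (hrange : Set.range j = {x}ᶜ) :
    Nonempty (M ≃ₜ Metric.sphere (0 : EuclideanSpace ℝ (Fin (n + 1))) 1) :=
  ⟨(OnePoint.equivOfIsEmbeddingOfRangeEq x j hj.toIsEmbedding hrange).symm.trans
    (onePointEquivSphereOfFinrankEq (by simp))⟩

end Basin

/-! ### Functions with two critical points -/

section TwoCriticalPoints

/-- Near the origin, `G` strictly increases along the rays towards the origin. -/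
def IsStrictRadialMax {E : Type*} [NormedAddCommGroup E] [NormedSpace ℝ E] (G : E → ℝ) : Prop :=
  ∀ᶠ y in 𝓝 0, y ≠ 0 → ∀ c ∈ Set.Ioo (0 : ℝ) 1, G y < G (c • y)

/-- In some topological chart centred at `x` and modelled on `E`, the function `g` has a strict
radial maximum. It is the substitute for a nondegenerate maximum in Reeb's theorem. -/
def HasRadialMaxAt {M : Type*} (E : Type*) [TopologicalSpace M] [NormedAddCommGroup E]
    [NormedSpace ℝ E] (g : M → ℝ) (x : M) : Prop :=
  ∃ φ : OpenPartialHomeomorph M E, x ∈ φ.source ∧ φ x = 0 ∧ IsStrictRadialMax (g ∘ φ.symm)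

/-- In some topological chart around `x` and modelled on `E`, the function `g` has a nonzero strict
derivative at `x`. -/
def IsRegularAt {M : Type*} (E : Type*) [TopologicalSpace M] [NormedAddCommGroup E]
    [NormedSpace ℝ E] (g : M → ℝ) (x : M) : Prop :=
  ∃ φ : OpenPartialHomeomorph M E, x ∈ φ.source ∧
    ∃ G' : E →L[ℝ] ℝ, G' ≠ 0 ∧ HasStrictFDerivAt (g ∘ φ.symm) G' (φ x)

theorem eventually_lt_add_smul_of_hasStrictFDerivAt {E : Type*} [NormedAddCommGroup E]
    [NormedSpace ℝ E] {G : E → ℝ} {G' : E →L[ℝ] ℝ} {y₀ w : E} (hG : HasStrictFDerivAt G G' y₀)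
    (hw : 0 < G' w) : ∀ᶠ p : E × ℝ in 𝓝 y₀ ×ˢ 𝓝[>] 0, G p.1 < G (p.1 + p.2 • w) := by
  have hw_norm : 0 < ‖w‖ := norm_pos_iff.2 fun h => by simp [h] at hw
  have hbound := hG.isLittleO.bound (show 0 < G' w / (2 * ‖w‖) by positivity)
  have hfst : Filter.Tendsto (Prod.fst : E × ℝ → E) (𝓝 y₀ ×ˢ 𝓝[>] 0) (𝓝 y₀) :=
    Filter.tendsto_fst
  have hsnd : Filter.Tendsto (Prod.snd : E × ℝ → ℝ) (𝓝 y₀ ×ˢ 𝓝[>] 0) (𝓝[>] 0) :=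
    Filter.tendsto_snd
  have hadd : Filter.Tendsto (fun p : E × ℝ => p.1 + p.2 • w) (𝓝 y₀ ×ˢ 𝓝[>] 0) (𝓝 y₀) := by
    simpa only [zero_smul, add_zero] using
      hfst.add ((hsnd.mono_right nhdsWithin_le_nhds).smul_const w)
  filter_upwards [(hadd.prodMk_nhds hfst).eventually hbound,
    hsnd.eventually self_mem_nhdsWithin] with ⟨y, t⟩ hyt (ht : 0 < t)
  simp only [add_sub_cancel_left, map_smul, smul_eq_mul, norm_smul, Real.norm_of_nonneg ht.le,
    Real.norm_eq_abs] at hyt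
  have hscale : G' w / (2 * ‖w‖) * (t * ‖w‖) = t * G' w / 2 := by field_simp
  rw [hscale] at hyt
  have hpos : 0 < t * G' w := mul_pos ht hw
  linarith [(abs_le.1 hyt).1]

theorem exists_pos_apply_of_ne_zero {E : Type*} [NormedAddCommGroup E] [NormedSpace ℝ E]
    {G' : E →L[ℝ] ℝ} (hG' : G' ≠ 0) : ∃ w, 0 < G' w := by
  obtain ⟨w, hw⟩ := DFunLike.ne_iff.1 hG'
  rcases lt_or_gt_of_ne hw with hneg | hpos
  · exact ⟨-w, by rw [map_neg]; exact neg_pos.2 hneg⟩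
  · exact ⟨w, hpos⟩

variable {M E : Type*} [TopologicalSpace M] [T2Space M] [NormedAddCommGroup E]
  [NormedSpace ℝ E] [FiniteDimensional ℝ E] {g : M → ℝ} {x : M} {O : Set M}

theorem exists_homeomorph_isIncreasingFor_near (φ : OpenPartialHomeomorph M E) (hx : x ∈ φ.source)
    (hO : O ∈ 𝓝 x) {V : E → E} (hV : ContDiff ℝ 1 V)
    (hg : ∀ᶠ p : E × ℝ in 𝓝 (φ x) ×ˢ 𝓝[>] 0,
      V p.1 ≠ 0 → g (φ.symm p.1) < g (φ.symm (p.1 + p.2 • V p.1))) {δ : ℝ} (hδ : 0 < δ) :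
    ∃ ε ∈ Set.Ioo 0 δ, ∃ Ψ : M ≃ₜ M, IsIncreasingFor g Ψ ∧ (∀ z ∉ O, Ψ z = z) ∧
      ∀ᶠ y in 𝓝 (φ x), Ψ (φ.symm y) = φ.symm (y + ε • V y) ∧
        (V y ≠ 0 → g (φ.symm y) < g (φ.symm (y + ε • V y))) := by
  have : CompleteSpace E := FiniteDimensional.complete ℝ E
  have hxt := φ.map_source hx
  obtain ⟨⟨r, δ'⟩, ⟨hr, hδ'⟩, hinc⟩ :=
    (Metric.nhds_basis_ball.prod (nhdsGT_basis (0 : ℝ))).eventually_iff.1 hg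
  have hnhds : φ.target ∩ φ.symm ⁻¹' O ∩ Metric.ball (φ x) r ∈ 𝓝 (φ x) :=
    Filter.inter_mem (Filter.inter_mem (φ.open_target.mem_nhds hxt)
      (φ.continuousAt_symm hxt (by rwa [φ.left_inv hx]))) (Metric.ball_mem_nhds _ hr)
  obtain ⟨ρ, hρ, hball⟩ := Metric.nhds_basis_closedBall.mem_iff.1 hnhds
  let b : ContDiffBump (φ x) := ⟨ρ / 2, ρ, by positivity, by linarith⟩
  have htsupp : tsupport (fun y => b y • V y) ⊆ Metric.closedBall (φ x) ρ :=
    (tsupport_smul_subset_left _ _).trans b.tsupport_eq.subset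
  obtain ⟨ε, hε, Ψ, hΨ, hid, happly⟩ := exists_homeomorph_isIncreasingFor φ (g := g)
    (W := fun y => b y • V y) (b.contDiff.smul hV) b.hasCompactSupport.smul_right
    (fun y hy => (hball (htsupp hy)).1.1) (lt_min hδ hδ') fun y hy t ht => by
      have hyρ : y ∈ Metric.closedBall (φ x) ρ := htsupp (subset_tsupport _ hy)
      have hby : 0 < b y := b.nonneg.lt_of_ne' fun h => hy (by rw [h, zero_smul])
      have hVy : V y ≠ 0 := fun h => hy (by rw [h, smul_zero])
      rw [smul_smul]
      refine hinc (x := (y, t * b y)) ⟨(hball hyρ).2, mul_pos ht.1 hby, ?_⟩ hVy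
      calc t * b y ≤ t * 1 := by gcongr; exacts [ht.1.le, b.le_one]
        _ < δ' := by linarith [ht.2, min_le_right δ δ']
  refine ⟨ε, ⟨hε.1, hε.2.trans_le (min_le_left _ _)⟩, Ψ, hΨ, fun z hz => hid z ?_, ?_⟩
  · rintro ⟨y, hy, rfl⟩
    exact hz (hball (htsupp hy)).1.2
  · filter_upwards [hnhds, b.eventuallyEq_one] with y hy hby
    rw [happly y hy.1.1, hby, Pi.one_apply, one_smul]
    exact ⟨rfl, hinc (x := (y, ε)) ⟨hy.2, hε.1, hε.2.trans_le (min_le_right _ _)⟩⟩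

theorem IsRegularAt.exists_isIncreasingFor (hreg : IsRegularAt E g x) (hO : O ∈ 𝓝 x) :
    ∃ Ψ : M ≃ₜ M, IsIncreasingFor g Ψ ∧ (∀ z ∉ O, Ψ z = z) ∧ ∀ᶠ z in 𝓝 x, Ψ z ≠ z := by
  obtain ⟨φ, hx, G', hG', hG⟩ := hreg
  obtain ⟨w, hw⟩ := exists_pos_apply_of_ne_zero hG'
  obtain ⟨ε, -, Ψ, hΨ, hid, hnear⟩ := exists_homeomorph_isIncreasingFor_near φ hx hO
    (V := fun _ => w) contDiff_const
    ((eventually_lt_add_smul_of_hasStrictFDerivAt hG hw).mono fun _ hp _ => hp) one_pos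
  refine ⟨Ψ, hΨ, hid, ?_⟩
  filter_upwards [φ.open_source.mem_nhds hx, (φ.continuousAt hx).eventually hnear]
    with z hz ⟨happly, hlt⟩ hfix
  have hw_ne : w ≠ 0 := fun h => by simp [h] at hw
  refine (hlt hw_ne).ne ?_
  rw [← happly, φ.left_inv hz, hfix]

theorem exists_isIncreasingFor_of_isCompact {K : Set M} (hK : IsCompact K)
    (hO : ∀ x ∈ K, O ∈ 𝓝 x) (hreg : ∀ x ∈ K, IsRegularAt E g x) :
    ∃ Ψ : M ≃ₜ M, IsIncreasingFor g Ψ ∧ (∀ z ∉ O, Ψ z = z) ∧ ∀ z ∈ K, Ψ z ≠ z := by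
  refine hK.induction_on (p := fun S => ∃ Ψ : M ≃ₜ M, IsIncreasingFor g Ψ ∧
    (∀ z ∉ O, Ψ z = z) ∧ ∀ z ∈ S, Ψ z ≠ z) ?_ ?_ ?_ ?_
  · exact ⟨Homeomorph.refl M, fun x => Or.inl rfl, fun z _ => rfl, fun z hz => hz.elim⟩
  · rintro s t hst ⟨Ψ, hΨ, hid, hmove⟩
    exact ⟨Ψ, hΨ, hid, fun z hz => hmove z (hst hz)⟩
  · rintro s t ⟨Ψ, hΨ, hid, hmove⟩ ⟨Ψ', hΨ', hid', hmove'⟩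
    refine ⟨Ψ.trans Ψ', hΨ'.comp hΨ, fun z hz => ?_, fun z hz hfix => ?_⟩
    · rw [Homeomorph.trans_apply, hid z hz, hid' z hz]
    · obtain ⟨hfixΨ, hfixΨ'⟩ := hΨ'.comp_eq_self hΨ hfix
      exact hz.elim (fun hzs => hmove z hzs hfixΨ) fun hzt => hmove' z hzt hfixΨ'
  · intro x hx
    obtain ⟨Ψ, hΨ, hid, hmove⟩ := (hreg x hx).exists_isIncreasingFor (hO x hx)
    exact ⟨_, mem_nhdsWithin_of_mem_nhds hmove, Ψ, hΨ, hid, fun z hz => hz⟩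

theorem HasRadialMaxAt.exists_isLinearContraction (hg : HasRadialMaxAt E g x) (hO : O ∈ 𝓝 x) :
    ∃ Ψ : M ≃ₜ M, IsIncreasingFor g Ψ ∧ (∀ z ∉ O, Ψ z = z) ∧
      ∃ (φ : OpenPartialHomeomorph M E) (R c : ℝ), φ.symm 0 = x ∧ IsLinearContraction Ψ φ R c := by
  obtain ⟨φ, hx, hφx, hmax⟩ := hg
  have htoward (y : E) (t : ℝ) : y + t • -y = (1 - t) • y := by
    rw [sub_smul, one_smul, smul_neg, sub_eq_add_neg]
  have hinc : ∀ᶠ p : E × ℝ in 𝓝 (φ x) ×ˢ 𝓝[>] 0,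
      -p.1 ≠ 0 → g (φ.symm p.1) < g (φ.symm (p.1 + p.2 • -p.1)) := by
    rw [hφx]
    filter_upwards [Filter.Eventually.prod_mk hmax (Ioo_mem_nhdsGT (one_pos (α := ℝ)))]
      with ⟨y, t⟩ ⟨hy, ht⟩ hy0
    rw [htoward]
    exact hy (neg_ne_zero.1 hy0) (1 - t) ⟨by linarith [ht.2], by linarith [ht.1]⟩
  obtain ⟨ε, hε, Ψ, hΨ, hid, hnear⟩ :=
    exists_homeomorph_isIncreasingFor_near φ hx hO contDiff_neg hinc one_pos
  rw [hφx] at hnear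
  have htarget : φ.target ∈ 𝓝 0 := hφx ▸ φ.open_target.mem_nhds (φ.map_source hx)
  obtain ⟨R, hR, hball⟩ := Metric.nhds_basis_closedBall.mem_iff.1 (Filter.inter_mem htarget hnear)
  refine ⟨Ψ, hΨ, hid, φ, R, 1 - ε, by rw [← hφx, φ.left_inv hx], hR, by linarith [hε.2],
    by linarith [hε.1], fun y hy => (hball hy).1, fun y hy => ?_⟩
  rw [(hball hy).2.1, htoward]

variable [CompactSpace M]

theorem IsLinearContraction.exists_isIncreasingFor_forall_eq_self {Ψ Ψ' : M ≃ₜ M}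
    {φ φ' : OpenPartialHomeomorph M E} {R R' c c' : ℝ} (hcontr : IsLinearContraction Ψ φ R c)
    (hcontr' : IsLinearContraction Ψ' φ' R' c') (hΨ : IsIncreasingFor g Ψ)
    (hΨ' : IsIncreasingFor (-g) Ψ') (hΨ_min : Ψ (φ'.symm 0) = φ'.symm 0)
    (hΨ'_ball : ∀ x ∈ φ.symm '' Metric.closedBall 0 R, Ψ' x = x)
    (hreg : ∀ x, x ≠ φ'.symm 0 → x ≠ φ.symm 0 → IsRegularAt E g x) :
    ∃ Φ : M ≃ₜ M, IsIncreasingFor g Φ ∧ Φ (φ'.symm 0) = φ'.symm 0 ∧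
      (∀ x, Φ x = x → x = φ'.symm 0 ∨ x = φ.symm 0) ∧ IsLinearContraction Φ φ (R / 2) c := by
  have hhalf := hcontr.mono (half_pos hcontr.radius_pos) (half_le_self hcontr.radius_pos.le)
  have hhalf_ball : φ.symm '' Metric.closedBall 0 (R / 2) ⊆ φ.symm '' Metric.ball 0 R :=
    Set.image_mono (Metric.closedBall_subset_ball (half_lt_self hcontr.radius_pos))
  set K : Set M := (φ.symm '' Metric.ball 0 R ∪ φ'.symm '' Metric.ball 0 R')ᶜ
  set P : Set M := φ.symm '' Metric.closedBall 0 (R / 2) ∪ {φ'.symm 0}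
  have hK : IsCompact K :=
    (hcontr.isOpen_image_ball.union hcontr'.isOpen_image_ball).isClosed_compl.isCompact
  have hKP : K ⊆ Pᶜ := Set.compl_subset_compl.2 <| Set.union_subset_union hhalf_ball <|
    Set.singleton_subset_iff.2 hcontr'.symm_zero_mem_image_ball
  have hP : IsOpen Pᶜ := (hhalf.isClosed_image_closedBall.union isClosed_singleton).isOpen_compl
  obtain ⟨Θ, hΘ, hΘ_id, hΘ_move⟩ := exists_isIncreasingFor_of_isCompact hK
    (fun x hx => hP.mem_nhds (hKP hx)) fun x hx => hreg x
      (fun h => hx (Or.inr (h ▸ hcontr'.symm_zero_mem_image_ball)))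
      (fun h => hx (Or.inl (h ▸ hcontr.symm_zero_mem_image_ball)))
  have hΘ_fix : ∀ x ∈ P, Θ x = x := fun x hx => hΘ_id x (Set.notMem_compl_iff.2 hx)
  have hΨΨ' : IsIncreasingFor g (Ψ'.symm.trans Ψ) := hΨ.comp hΨ'.symm_of_neg
  refine ⟨Θ.trans (Ψ'.symm.trans Ψ), hΨΨ'.comp hΘ, ?_, fun x hfix => ?_,
    { hhalf with apply_symm := fun y hy => ?_ }⟩
  · rw [Homeomorph.trans_apply, Homeomorph.trans_apply, hΘ_fix _ (Or.inr rfl),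
      Ψ'.symm_apply_eq.2 hcontr'.apply_symm_zero.symm, hΨ_min]
  · obtain ⟨hΘx, hfix⟩ := hΨΨ'.comp_eq_self hΘ hfix
    obtain ⟨hΨ'x, hΨx⟩ := hΨ.comp_eq_self hΨ'.symm_of_neg hfix
    by_contra! hx
    refine hΘ_move x (fun hball => hball.elim ?_ ?_) hΘx
    · exact fun h => hcontr.notMem_image_ball hΨx hx.2 h
    · exact fun h => hcontr'.notMem_image_ball (Ψ'.symm_apply_eq.1 hΨ'x).symm hx.1 h
  · have hyP : φ.symm y ∈ φ.symm '' Metric.closedBall 0 (R / 2) := ⟨y, hy, rfl⟩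
    have hΨ'y := hΨ'_ball _ (Set.image_mono Metric.ball_subset_closedBall (hhalf_ball hyP))
    rw [Homeomorph.trans_apply, Homeomorph.trans_apply, hΘ_fix _ (Or.inl hyP),
      Ψ'.symm_apply_eq.2 hΨ'y.symm, hhalf.apply_symm y hy]

variable {xmin xmax : M}

theorem exists_isIncreasingFor_isLinearContraction (hne : xmax ≠ xmin)
    (hreg : ∀ x, x ≠ xmin → x ≠ xmax → IsRegularAt E g x) (hmax : HasRadialMaxAt E g xmax)
    (hmin : HasRadialMaxAt E (-g) xmin) :
    ∃ Φ : M ≃ₜ M, IsIncreasingFor g Φ ∧ Φ xmin = xmin ∧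
      (∀ x, Φ x = x → x = xmin ∨ x = xmax) ∧
      ∃ (φ : OpenPartialHomeomorph M E) (R c : ℝ), φ.symm 0 = xmax ∧
        IsLinearContraction Φ φ R c := by
  obtain ⟨Ψ, hΨ, hΨ_id, φ, R, c, rfl, hcontr⟩ :=
    hmax.exists_isLinearContraction (isOpen_compl_singleton.mem_nhds hne)
  have hΨ_min : Ψ xmin = xmin := hΨ_id xmin fun h => h rfl
  obtain ⟨Ψ', hΨ', hΨ'_id, φ', R', c', rfl, hcontr'⟩ := hmin.exists_isLinearContraction <|
    hcontr.isClosed_image_closedBall.isOpen_compl.mem_nhds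
      (hcontr.notMem_image_closedBall hΨ_min hne.symm)
  obtain ⟨Φ, hΦ, hΦ_min, hfix, hcontrΦ⟩ := hcontr.exists_isIncreasingFor_forall_eq_self hcontr' hΨ
    hΨ' hΨ_min (fun x hx => hΨ'_id x (Set.notMem_compl_iff.2 hx)) hreg
  exact ⟨Φ, hΦ, hΦ_min, hfix, φ, R / 2, c, rfl, hcontrΦ⟩

theorem nonempty_homeomorph_sphere_of_two_critical_points {n : ℕ} {xmin xmax : M}
    (hg : Continuous g) (hne : xmax ≠ xmin)
    (hreg : ∀ x, x ≠ xmin → x ≠ xmax → IsRegularAt (EuclideanSpace ℝ (Fin n)) g x)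
    (hmax : HasRadialMaxAt (EuclideanSpace ℝ (Fin n)) g xmax)
    (hmin : HasRadialMaxAt (EuclideanSpace ℝ (Fin n)) (-g) xmin)
    (hmin_lt : ∀ x, x ≠ xmin → g xmin < g x) :
    Nonempty (M ≃ₜ Metric.sphere (0 : EuclideanSpace ℝ (Fin (n + 1))) 1) := by
  obtain ⟨Φ, hΦ, hΦ_min, hfix, φ, R, c, rfl, hcontr⟩ :=
    exists_isIncreasingFor_isLinearContraction hne hreg hmax hmin
  exact nonempty_homeomorph_sphere_of_isOpenEmbedding hcontr.isOpenEmbedding_basinMap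
    (hcontr.range_basinMap_eq_compl_singleton hg hΦ hΦ_min hmin_lt hne hfix)

end TwoCriticalPoints

/-! ### Second-order conditions -/

section SecondDerivative

variable {E V W : Type*} [NormedAddCommGroup E] [NormedSpace ℝ E] [NormedAddCommGroup V]
  [NormedSpace ℝ V] [NormedAddCommGroup W] [NormedSpace ℝ W]

theorem tendsto_smul_const_nhds_zero (w : E) :
    Filter.Tendsto (fun t : ℝ => t • w) (𝓝 0) (𝓝 0) :=
  Continuous.tendsto' (by fun_prop) 0 0 (zero_smul ℝ w)

theorem eventually_differentiableAt_of_contDiffAt {F : E → V} {x : E} (hF : ContDiffAt ℝ 2 F x) :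
    ∀ᶠ y in 𝓝 x, DifferentiableAt ℝ F y :=
  (hF.eventually (by simp)).mono fun _ hy => hy.differentiableAt two_ne_zero

theorem hasFDerivAt_fderiv {F : E → V} {x : E} (hF : ContDiffAt ℝ 2 F x) :
    HasFDerivAt (fderiv ℝ F) (fderiv ℝ (fderiv ℝ F) x) x :=
  ((hF.fderiv_right (m := 1) (by norm_num)).differentiableAt one_ne_zero).hasFDerivAt

theorem fderiv_fderiv_clm_comp {F : E → V} {x : E} (hF : ContDiffAt ℝ 2 F x) (L : V →L[ℝ] W)
    (v w : E) :
    fderiv ℝ (fderiv ℝ (L ∘ F)) x v w = L (fderiv ℝ (fderiv ℝ F) x v w) := by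
  have h := congr($(L.iteratedFDeriv_comp_left hF (i := 2) le_rfl) ![v, w])
  rwa [iteratedFDeriv_two_apply, ContinuousLinearMap.compContinuousMultilinearMap_coe,
    Function.comp_apply, iteratedFDeriv_two_apply] at h

theorem hasDerivAt_comp_smul_const {F : E → V} {w : E} {t : ℝ}
    (hF : DifferentiableAt ℝ F (t • w)) :
    HasDerivAt (fun s : ℝ => F (s • w)) (fderiv ℝ F (t • w) w) t := by
  have hline : HasDerivAt (fun s : ℝ => s • w) w t := by
    simpa only [id_eq, one_smul] using (hasDerivAt_id t).smul_const w
  exact hF.hasFDerivAt.comp_hasDerivAt t hline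

theorem hasDerivAt_fderiv_smul_const {F : E → V} (hF : ContDiffAt ℝ 2 F 0) (w : E) :
    HasDerivAt (fun t : ℝ => fderiv ℝ F (t • w) w) (fderiv ℝ (fderiv ℝ F) 0 w w) 0 := by
  have hF' := hasFDerivAt_fderiv hF
  rw [← zero_smul ℝ w] at hF'
  have h := (hasDerivAt_comp_smul_const hF'.differentiableAt).clm_apply (hasDerivAt_const 0 w)
  simpa only [zero_smul, map_zero, add_zero] using h

theorem isCoercive_of_forall_pos [FiniteDimensional ℝ E] {B : E →L[ℝ] E →L[ℝ] ℝ}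
    (hB : ∀ w, w ≠ 0 → 0 < B w w) : IsCoercive B := by
  rcases subsingleton_or_nontrivial E with _ | _
  · exact ⟨1, one_pos, fun w => by simp [Subsingleton.elim w 0]⟩
  have hcont : Continuous fun w => B w w := by fun_prop
  obtain ⟨w₀, hw₀, hmin⟩ := (isCompact_sphere (0 : E) 1).exists_isMinOn
    (NormedSpace.sphere_nonempty.2 zero_le_one) hcont.continuousOn
  refine ⟨B w₀ w₀, hB w₀ (ne_zero_of_mem_unit_sphere ⟨w₀, hw₀⟩), fun w => ?_⟩
  rcases eq_or_ne w 0 with rfl | hw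
  · simp
  have hnorm : ‖w‖ ≠ 0 := norm_ne_zero_iff.2 hw
  have hle : B w₀ w₀ ≤ B (‖w‖⁻¹ • w) (‖w‖⁻¹ • w) :=
    hmin (mem_sphere_zero_iff_norm.2 (norm_smul_inv_norm hw))
  calc B w₀ w₀ * ‖w‖ * ‖w‖ ≤ B (‖w‖⁻¹ • w) (‖w‖⁻¹ • w) * ‖w‖ * ‖w‖ := by gcongr
    _ = B w w := by
      simp only [map_smul, smul_apply, smul_eq_mul]
      field_simp

theorem eventually_fderiv_apply_self_neg {G : E → ℝ} (hG : ContDiffAt ℝ 2 G 0)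
    (hfirst : fderiv ℝ G 0 = 0) (hsecond : IsCoercive (-fderiv ℝ (fderiv ℝ G) 0)) :
    ∀ᶠ z in 𝓝 (0 : E), z ≠ 0 → fderiv ℝ G z z < 0 := by
  obtain ⟨c, hc, hcoercive⟩ := hsecond
  filter_upwards [(hasFDerivAt_fderiv hG).isLittleO.bound (half_pos hc)] with z hz hz0
  rw [hfirst, sub_zero, sub_zero] at hz
  have hbound : ‖(fderiv ℝ G z - fderiv ℝ (fderiv ℝ G) 0 z) z‖ ≤ c / 2 * ‖z‖ * ‖z‖ :=
    (ContinuousLinearMap.le_opNorm _ _).trans (by gcongr)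
  have hle := (abs_le.1 hbound).2
  have hquad := hcoercive z
  simp only [sub_apply, neg_apply] at hle hquad
  have hpos : 0 < c * (‖z‖ * ‖z‖) := by positivity
  linarith

theorem isStrictRadialMax_of_fderiv_apply_self_neg {G : E → ℝ}
    (hdiff : ∀ᶠ z in 𝓝 (0 : E), DifferentiableAt ℝ G z)
    (hneg : ∀ᶠ z in 𝓝 (0 : E), z ≠ 0 → fderiv ℝ G z z < 0) : IsStrictRadialMax G := by
  obtain ⟨r, hr, hball⟩ := Metric.eventually_nhds_iff_ball.1 (hdiff.and hneg)
  filter_upwards [Metric.ball_mem_nhds (0 : E) hr] with y hy hy0 c hc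
  have hmem : ∀ s ∈ Set.Icc c 1, s • y ∈ Metric.ball (0 : E) r := fun s hs => by
    rw [mem_ball_zero_iff, norm_smul, Real.norm_of_nonneg (hc.1.le.trans hs.1)]
    exact (mul_le_of_le_one_left (norm_nonneg y) hs.2).trans_lt (mem_ball_zero_iff.1 hy)
  have hderiv : ∀ s ∈ Set.Icc c 1,
      HasDerivAt (fun s : ℝ => G (s • y)) (fderiv ℝ G (s • y) y) s :=
    fun s hs => hasDerivAt_comp_smul_const (hball _ (hmem s hs)).1
  have hanti : StrictAntiOn (fun s : ℝ => G (s • y)) (Set.Icc c 1) := by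
    refine strictAntiOn_of_deriv_neg (convex_Icc c 1)
      (fun s hs => (hderiv s hs).continuousAt.continuousWithinAt) fun s hs => ?_
    have hs' : s ∈ Set.Icc c 1 := interior_subset hs
    have hs0 : 0 < s := hc.1.trans_le hs'.1
    rw [(hderiv s hs').deriv]
    have h := (hball _ (hmem s hs')).2 (smul_ne_zero hs0.ne' hy0)
    rw [map_smul, smul_eq_mul] at h
    exact neg_of_mul_neg_right h hs0.le
  simpa only [one_smul] using hanti (Set.left_mem_Icc.2 hc.2.le) (Set.right_mem_Icc.2 hc.2.le) hc.2

theorem isStrictRadialMax_of_fderiv_fderiv_neg [FiniteDimensional ℝ E] {G : E → ℝ}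
    (hG : ContDiffAt ℝ 2 G 0) (hfirst : fderiv ℝ G 0 = 0)
    (hsecond : ∀ w, w ≠ 0 → fderiv ℝ (fderiv ℝ G) 0 w w < 0) : IsStrictRadialMax G :=
  isStrictRadialMax_of_fderiv_apply_self_neg (eventually_differentiableAt_of_contDiffAt hG) <|
    eventually_fderiv_apply_self_neg hG hfirst <| isCoercive_of_forall_pos fun w hw => by
      simpa only [neg_apply, neg_pos] using hsecond w hw

theorem deriv_deriv_nonpos_of_isLocalMax {k : ℝ → ℝ} {t : ℝ} (hmax : IsLocalMax k t)
    (hk : ContinuousAt k t) : deriv (deriv k) t ≤ 0 := by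
  by_contra! hpos
  have hmin := isLocalMin_of_deriv_deriv_pos hpos hmax.deriv_eq_zero hk
  have hconst : k =ᶠ[𝓝 t] fun _ => k t := by
    filter_upwards [hmax, hmin] with s hle hge using le_antisymm hle hge
  rw [hconst.deriv.deriv_eq, deriv_const', deriv_const] at hpos
  exact lt_irrefl 0 hpos

end SecondDerivative

section NormMax

theorem isLocalMax_norm_sq {X V : Type*} [TopologicalSpace X] [SeminormedAddGroup V] {F : X → V}
    {x : X} (hmax : IsLocalMax (fun y => ‖F y‖) x) : IsLocalMax (fun y => ‖F y‖ ^ 2) x :=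
  hmax.mono fun _ hy => pow_le_pow_left₀ (norm_nonneg _) hy 2

variable {E V : Type*} [NormedAddCommGroup E] [NormedSpace ℝ E] [NormedAddCommGroup V]
  [InnerProductSpace ℝ V] {F : E → V}

theorem inner_fderiv_eq_zero_of_isLocalMax_norm {x : E} (hF : DifferentiableAt ℝ F x)
    (hmax : IsLocalMax (fun y => ‖F y‖) x) (w : E) : inner ℝ (F x) (fderiv ℝ F x w) = 0 := by
  have h := congr($((isLocalMax_norm_sq hmax).hasFDerivAt_eq_zero hF.hasFDerivAt.norm_sq) w)
  simpa using h

theorem inner_fderiv_fderiv_add_norm_sq_nonpos (hF : ContDiffAt ℝ 2 F 0)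
    (hmax : IsLocalMax (fun y => ‖F y‖) 0) (w : E) :
    inner ℝ (F 0) (fderiv ℝ (fderiv ℝ F) 0 w w) + ‖fderiv ℝ F 0 w‖ ^ 2 ≤ 0 := by
  have hfirst : ∀ᶠ t : ℝ in 𝓝 0, HasDerivAt (fun t : ℝ => F (t • w)) (fderiv ℝ F (t • w) w) t :=
    ((tendsto_smul_const_nhds_zero w).eventually
      (eventually_differentiableAt_of_contDiffAt hF)).mono fun t => hasDerivAt_comp_smul_const
  have hsq : ∀ᶠ t : ℝ in 𝓝 0, HasDerivAt (fun t : ℝ => ‖F (t • w)‖ ^ 2)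
      (2 * inner ℝ (F (t • w)) (fderiv ℝ F (t • w) w)) t := hfirst.mono fun t ht => ht.norm_sq
  have hsecond : HasDerivAt (deriv fun t : ℝ => ‖F (t • w)‖ ^ 2)
      (2 * (inner ℝ (F ((0 : ℝ) • w)) (fderiv ℝ (fderiv ℝ F) 0 w w) +
        inner ℝ (fderiv ℝ F ((0 : ℝ) • w) w) (fderiv ℝ F ((0 : ℝ) • w) w))) 0 :=
    ((hfirst.self_of_nhds.inner ℝ (hasDerivAt_fderiv_smul_const hF w)).const_mul
      2).congr_of_eventuallyEq (hsq.mono fun t ht => ht.deriv)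
  have hmax_line : IsLocalMax (fun t : ℝ => ‖F (t • w)‖ ^ 2) 0 := by
    filter_upwards [(tendsto_smul_const_nhds_zero w).eventually (isLocalMax_norm_sq hmax)] with t ht
    rwa [zero_smul]
  have hnonpos := deriv_deriv_nonpos_of_isLocalMax hmax_line hsq.self_of_nhds.continuousAt
  rw [hsecond.deriv, zero_smul, real_inner_self_eq_norm_sq] at hnonpos
  linarith

end NormMax

/-! ### The local form of a fold -/

section FoldForm

variable {E V : Type*} [NormedAddCommGroup E] [NormedSpace ℝ E] [NormedAddCommGroup V]
  [InnerProductSpace ℝ V]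

/-- `F` is a fold at the origin: `F (t w) = P (t u(w) + t² s(w) q)` for small `t`, where the
differential of `P` at `0` is onto, `q` spans a complement of the range of `u`, and `s` vanishes
nowhere on the kernel of `u` except at `0`. Requiring this only along lines through the origin keeps
the homogeneity of `s` out of the definition. -/
structure IsFoldForm (F : E → V) (P : V → V) (u : E →ₗ[ℝ] V) (s : E → ℝ) (q : V) : Prop where
  contDiffAt : ContDiffAt ℝ 2 F 0
  contDiffAt_cod : ContDiffAt ℝ 2 P 0
  surjective : Function.Surjective (fderiv ℝ P 0)
  eq_zero : ∀ w, u w = 0 → s w = 0 → w = 0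
  exists_add : ∀ y, ∃ (w : E) (c : ℝ), y = u w + c • q
  apply_smul : ∀ w, ∀ᶠ t : ℝ in 𝓝 0, F (t • w) = P (t • u w + t ^ 2 • s w • q)

namespace IsFoldForm

variable {F : E → V} {P : V → V} {u : E →ₗ[ℝ] V} {s : E → ℝ} {q : V}

theorem eventually_hasDerivAt (h : IsFoldForm F P u s q) (w : E) : ∀ᶠ t : ℝ in 𝓝 0,
    HasDerivAt (fun t : ℝ => F (t • w))
      (fderiv ℝ P (t • u w + t ^ 2 • s w • q) (u w + (2 * t) • s w • q)) t := by
  have htend : Filter.Tendsto (fun t : ℝ => t • u w + t ^ 2 • s w • q) (𝓝 0) (𝓝 0) :=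
    Continuous.tendsto' (by fun_prop) 0 0 (by simp)
  filter_upwards [(h.apply_smul w).eventually_nhds,
    htend.eventually (eventually_differentiableAt_of_contDiffAt h.contDiffAt_cod)] with t heq hdiff
  have hcurve : HasDerivAt (fun t : ℝ => t • u w + t ^ 2 • s w • q)
      (u w + (2 * t) • s w • q) t := by
    refine HasDerivAt.add (HasDerivAt.congr_deriv ((hasDerivAt_id t).smul_const (u w)) ?_)
      (HasDerivAt.congr_deriv (((hasDerivAt_id t).pow 2).smul_const (s w • q)) ?_) <;> simp
  exact (hdiff.hasFDerivAt.comp_hasDerivAt t hcurve).congr_of_eventuallyEq heq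

theorem eventually_fderiv_smul_apply (h : IsFoldForm F P u s q) (w : E) : ∀ᶠ t : ℝ in 𝓝 0,
    fderiv ℝ F (t • w) w = fderiv ℝ P (t • u w + t ^ 2 • s w • q) (u w + (2 * t) • s w • q) := by
  filter_upwards [h.eventually_hasDerivAt w, (tendsto_smul_const_nhds_zero w).eventually
    (eventually_differentiableAt_of_contDiffAt h.contDiffAt)] with t hfold hdiff
  exact (hasDerivAt_comp_smul_const hdiff).unique hfold

theorem fderiv_apply (h : IsFoldForm F P u s q) (w : E) :
    fderiv ℝ F 0 w = fderiv ℝ P 0 (u w) := by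
  simpa using (h.eventually_fderiv_smul_apply w).self_of_nhds

theorem fderiv_fderiv_apply (h : IsFoldForm F P u s q) {w : E} (hw : u w = 0) :
    fderiv ℝ (fderiv ℝ F) 0 w w = (2 * s w) • fderiv ℝ P 0 q := by
  have heq : (fun t : ℝ => fderiv ℝ F (t • w) w) =ᶠ[𝓝 0]
      fun t => (2 * t) • fderiv ℝ P (t ^ 2 • s w • q) (s w • q) := by
    filter_upwards [h.eventually_fderiv_smul_apply w] with t ht
    simpa only [hw, smul_zero, zero_add, map_smul] using ht
  have hP : DifferentiableAt ℝ (fderiv ℝ P) ((0 : ℝ) ^ 2 • s w • q) := by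
    rw [zero_pow two_ne_zero, zero_smul]
    exact (hasFDerivAt_fderiv h.contDiffAt_cod).differentiableAt
  have hcurve : DifferentiableAt ℝ (fun t : ℝ => t ^ 2 • s w • q) 0 := by fun_prop
  have hP' : DifferentiableAt ℝ (fun t : ℝ => fderiv ℝ P (t ^ 2 • s w • q) (s w • q)) 0 :=
    (hP.comp (0 : ℝ) hcurve).clm_apply (differentiableAt_const _)
  have hlin : HasDerivAt (fun t : ℝ => 2 * t) 2 0 := by
    simpa using (hasDerivAt_id (0 : ℝ)).const_mul 2
  rw [(hasDerivAt_fderiv_smul_const h.contDiffAt w).unique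
    ((hlin.smul hP'.hasDerivAt).congr_of_eventuallyEq heq)]
  simp [mul_smul]

theorem eq_zero_of_inner_eq_zero (h : IsFoldForm F P u s q) {b : V}
    (hb : ∀ w, inner ℝ b (fderiv ℝ F 0 w) = 0) (hbq : inner ℝ b (fderiv ℝ P 0 q) = 0) :
    b = 0 := by
  obtain ⟨y, hy⟩ := h.surjective b
  obtain ⟨w, c, rfl⟩ := h.exists_add y
  refine inner_self_eq_zero (𝕜 := ℝ).1 ?_
  calc inner ℝ b b = inner ℝ b (fderiv ℝ F 0 w + c • fderiv ℝ P 0 q) := by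
        rw [h.fderiv_apply, ← map_smul, ← map_add, hy]
    _ = 0 := by rw [inner_add_right, inner_smul_right, hb, hbq, mul_zero, add_zero]

theorem inner_smul_eq_inner_smul (h : IsFoldForm F P u s q) {a b : V}
    (ha : ∀ w, inner ℝ a (fderiv ℝ F 0 w) = 0) (hb : ∀ w, inner ℝ b (fderiv ℝ F 0 w) = 0) :
    (inner ℝ b (fderiv ℝ P 0 q) : ℝ) • a = (inner ℝ a (fderiv ℝ P 0 q) : ℝ) • b := by
  refine sub_eq_zero.1 (h.eq_zero_of_inner_eq_zero (fun w => ?_) ?_)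
  · rw [inner_sub_left, real_inner_smul_left, real_inner_smul_left, ha, hb, mul_zero, mul_zero,
      sub_zero]
  · rw [inner_sub_left, real_inner_smul_left, real_inner_smul_left, mul_comm, sub_self]

theorem eq_or_eq_neg (h : IsFoldForm F P u s q) {a b : V} (hab : ‖a‖ = ‖b‖)
    (ha : ∀ w, inner ℝ a (fderiv ℝ F 0 w) = 0) (hb : ∀ w, inner ℝ b (fderiv ℝ F 0 w) = 0) :
    a = b ∨ a = -b := by
  rcases eq_or_ne b 0 with rfl | hb0
  · exact Or.inl (by rwa [norm_zero, norm_eq_zero] at hab)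
  have hβ : (inner ℝ b (fderiv ℝ P 0 q) : ℝ) ≠ 0 :=
    fun hbq => hb0 (h.eq_zero_of_inner_eq_zero hb hbq)
  have hsmul := h.inner_smul_eq_inner_smul ha hb
  have habs : |(inner ℝ a (fderiv ℝ P 0 q) : ℝ)| = |(inner ℝ b (fderiv ℝ P 0 q) : ℝ)| := by
    have hnorm := congr(‖$hsmul‖)
    rw [norm_smul, norm_smul, hab] at hnorm
    exact (mul_right_cancel₀ (norm_ne_zero_iff.2 hb0) hnorm).symm
  rcases abs_eq_abs.1 habs with heq | heq <;> rw [heq] at hsmul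
  · exact Or.inl (smul_right_injective V hβ hsmul)
  · exact Or.inr (smul_right_injective V hβ (by rwa [neg_smul, ← smul_neg] at hsmul))

theorem inner_fderiv_fderiv_neg [FiniteDimensional ℝ V] (h : IsFoldForm F P u s q)
    (hF0 : F 0 ≠ 0) (hmax : IsLocalMax (fun y => ‖F y‖) 0) {w : E} (hw : w ≠ 0) :
    (inner ℝ (F 0) (fderiv ℝ (fderiv ℝ F) 0 w w) : ℝ) < 0 := by
  have hnonpos := inner_fderiv_fderiv_add_norm_sq_nonpos h.contDiffAt hmax w
  by_cases hw' : fderiv ℝ F 0 w = 0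
  · rw [hw', norm_zero, zero_pow two_ne_zero, add_zero] at hnonpos
    have hinj : Function.Injective (fderiv ℝ P 0) :=
      (LinearMap.injective_iff_surjective (f := (fderiv ℝ P 0 : V →ₗ[ℝ] V))).2 h.surjective
    have hu : u w = 0 := hinj (by rw [← h.fderiv_apply, hw', map_zero])
    refine lt_of_le_of_ne hnonpos ?_
    rw [h.fderiv_fderiv_apply hu, inner_smul_right]
    refine mul_ne_zero (mul_ne_zero two_ne_zero fun hs => hw (h.eq_zero w hu hs)) fun hq => hF0 ?_
    exact h.eq_zero_of_inner_eq_zero (inner_fderiv_eq_zero_of_isLocalMax_norm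
      (h.contDiffAt.differentiableAt two_ne_zero) hmax) hq
  · have hpos : 0 < ‖fderiv ℝ F 0 w‖ ^ 2 := by positivity
    linarith

theorem isStrictRadialMax_inner [FiniteDimensional ℝ E] [FiniteDimensional ℝ V]
    (h : IsFoldForm F P u s q) (hF0 : F 0 ≠ 0) (hmax : IsLocalMax (fun y => ‖F y‖) 0) :
    IsStrictRadialMax fun y => (inner ℝ (F 0) (F y) : ℝ) := by
  have hdiff : DifferentiableAt ℝ F 0 := h.contDiffAt.differentiableAt two_ne_zero
  refine isStrictRadialMax_of_fderiv_fderiv_neg (G := innerSL ℝ (F 0) ∘ F)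
    ((innerSL ℝ (F 0)).contDiff.contDiffAt.comp 0 h.contDiffAt) ?_ fun w hw => ?_
  · ext w
    rw [((innerSL ℝ (F 0)).hasFDerivAt.comp 0 hdiff.hasFDerivAt).fderiv]
    exact inner_fderiv_eq_zero_of_isLocalMax_norm hdiff hmax w
  · rw [fderiv_fderiv_clm_comp h.contDiffAt, innerSL_apply_apply]
    exact h.inner_fderiv_fderiv_neg hF0 hmax hw

end IsFoldForm

end FoldForm

/-! ### Definite folds in charts -/

section FoldModel

variable {n p : ℕ}

/-- The first `p - 1` coordinates of a vector of `ℝⁿ`, completed by a zero to a vector of `ℝᵖ`. If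
`n < p - 1`, then the missing coordinates are zero as well. -/
noncomputable def foldBase (p : ℕ) : EuclideanSpace ℝ (Fin n) →ₗ[ℝ] EuclideanSpace ℝ (Fin p) where
  toFun w := WithLp.toLp 2 fun j => if h : (j : ℕ) + 1 < p ∧ (j : ℕ) < n then w ⟨j, h.2⟩ else 0
  map_add' v w := by ext j; by_cases h : (j : ℕ) + 1 < p ∧ (j : ℕ) < n <;> simp [h]
  map_smul' t w := by ext j; by_cases h : (j : ℕ) + 1 < p ∧ (j : ℕ) < n <;> simp [h]

/-- The sum of the squares of the coordinates from the `p`-th one on (counting from one): the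
quadratic form of a definite fold. -/
noncomputable def foldSq (p : ℕ) (w : EuclideanSpace ℝ (Fin n)) : ℝ :=
  ∑ i : Fin n, if (i : ℕ) + 1 < p then 0 else w i ^ 2

/-- The last vector of the standard basis of `ℝᵖ`, the normal direction of the fold model. -/
noncomputable def foldDir (p : ℕ) [NeZero p] : EuclideanSpace ℝ (Fin p) :=
  EuclideanSpace.single ⟨p - 1, Nat.sub_one_lt (NeZero.ne p)⟩ 1

theorem foldBase_apply (w : EuclideanSpace ℝ (Fin n)) (j : Fin p) :
    foldBase p w j = if h : (j : ℕ) + 1 < p ∧ (j : ℕ) < n then w ⟨j, h.2⟩ else 0 := rfl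

theorem foldSq_smul (t : ℝ) (w : EuclideanSpace ℝ (Fin n)) :
    foldSq p (t • w) = t ^ 2 * foldSq p w := by
  simp only [foldSq, Finset.mul_sum]
  refine Finset.sum_congr rfl fun i _ => ?_
  split_ifs <;> simp [mul_pow]

theorem foldSq_zero : foldSq p (0 : EuclideanSpace ℝ (Fin n)) = 0 := by
  simp [foldSq]

theorem foldSq_nonneg (w : EuclideanSpace ℝ (Fin n)) : 0 ≤ foldSq p w :=
  Finset.sum_nonneg fun i _ => by split_ifs <;> positivity

theorem eq_zero_of_foldBase_of_foldSq {w : EuclideanSpace ℝ (Fin n)} (hbase : foldBase p w = 0)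
    (hsq : foldSq p w = 0) : w = 0 := by
  ext i
  by_cases hi : (i : ℕ) + 1 < p
  · have h := congr($hbase ⟨i, by omega⟩)
    simpa [foldBase_apply, hi] using h
  · have h := (Finset.sum_eq_zero_iff_of_nonneg fun i _ => by split_ifs <;> positivity).1 hsq i
      (Finset.mem_univ i)
    simpa [hi] using h

variable [NeZero p]

theorem foldDir_apply (j : Fin p) : foldDir p j = if (j : ℕ) + 1 = p then 1 else 0 := by
  have := NeZero.ne p
  rw [foldDir, PiLp.single_apply]
  exact if_congr (Fin.ext_iff.trans (by change (j : ℕ) = p - 1 ↔ _; omega)) rfl rfl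

theorem foldBase_add_smul_foldDir_apply (w : EuclideanSpace ℝ (Fin n)) (c : ℝ) (j : Fin p) :
    (foldBase p w + c • foldDir p) j = if (j : ℕ) + 1 = p then c else foldBase p w j := by
  rw [PiLp.add_apply, PiLp.smul_apply, foldDir_apply]
  split_ifs with h
  · rw [foldBase_apply, dif_neg (by omega), smul_eq_mul, mul_one, zero_add]
  · rw [smul_zero, add_zero]

theorem foldBase_add_inj {w w' : EuclideanSpace ℝ (Fin n)} {c c' : ℝ}
    (h : foldBase p w + c • foldDir p = foldBase p w' + c' • foldDir p) :
    foldBase p w = foldBase p w' ∧ c = c' := by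
  have hp := NeZero.ne p
  have hc : c = c' := by
    have hlast := congr($h ⟨p - 1, by omega⟩)
    simpa only [foldBase_add_smul_foldDir_apply, if_pos (Nat.sub_add_cancel (by omega : 1 ≤ p))]
      using hlast
  subst hc
  exact ⟨add_right_cancel h, rfl⟩

theorem exists_eq_foldBase_add (hpn : p ≤ n) (y : EuclideanSpace ℝ (Fin p)) :
    ∃ (w : EuclideanSpace ℝ (Fin n)) (c : ℝ), y = foldBase p w + c • foldDir p := by
  have hp := NeZero.ne p
  refine ⟨WithLp.toLp 2 fun i => if h : (i : ℕ) < p then y ⟨i, h⟩ else 0, y ⟨p - 1, by omega⟩, ?_⟩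
  ext j
  rw [foldBase_add_smul_foldDir_apply]
  split_ifs with h
  · rw [show j = ⟨p - 1, by omega⟩ from Fin.ext (Nat.eq_sub_of_add_eq h)]
  · simp [foldBase_apply, show (j : ℕ) + 1 < p ∧ (j : ℕ) < n by omega]

theorem foldBase_foldDir : foldBase p (foldDir p) = 0 := by
  ext j
  rw [foldBase_apply]
  split_ifs with h
  · simp [foldDir_apply, h.1.ne]
  · simp

theorem foldSq_foldDir : foldSq p (foldDir p) = 1 := by
  have hp := NeZero.ne p
  rw [foldSq, Finset.sum_eq_single ⟨p - 1, by omega⟩]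
  · simp [foldDir_apply, Nat.sub_add_cancel (by omega : 1 ≤ p)]
  · intro i _ hi
    have hi' : (i : ℕ) + 1 ≠ p := fun h => hi (Fin.ext (by simp; omega))
    simp [foldDir_apply, hi']
  · simp

theorem foldDir_ne_zero : foldDir p ≠ 0 := fun h =>
  zero_ne_one (foldSq_zero.symm.trans (h ▸ foldSq_foldDir))

theorem eq_smul_foldDir_or_eq_neg_smul_foldDir {w : EuclideanSpace ℝ (Fin p)}
    (hbase : foldBase p w = 0) {t : ℝ} (hsq : foldSq p w = t ^ 2) :
    w = t • foldDir p ∨ w = (-t) • foldDir p := by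
  have hp := NeZero.ne p
  obtain ⟨c, rfl⟩ : ∃ c : ℝ, w = c • foldDir p := by
    refine ⟨w ⟨p - 1, by omega⟩, ?_⟩
    ext i
    rw [PiLp.smul_apply, foldDir_apply]
    split_ifs with h
    · rw [show i = ⟨p - 1, by omega⟩ from Fin.ext (Nat.eq_sub_of_add_eq h), smul_eq_mul, mul_one]
    · have hi := congr($hbase i)
      rwa [foldBase_apply, dif_pos (by omega), PiLp.zero_apply, ← smul_zero (w _)] at hi
  rw [foldSq_smul, foldSq_foldDir, mul_one] at hsq
  rcases sq_eq_sq_iff_eq_or_eq_neg.1 hsq with rfl | rfl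
  · exact Or.inl rfl
  · exact Or.inr rfl

end FoldModel

section Chart

variable {n p : ℕ} {M : Type*} [TopologicalSpace M] [ChartedSpace (EuclideanSpace ℝ (Fin n)) M]

theorem contDiffAt_comp_symm {f : M → EuclideanSpace ℝ (Fin p)}
    (hf : ContMDiff (𝓡 n) (𝓡 p) ∞ f) {φ : OpenPartialHomeomorph M (EuclideanSpace ℝ (Fin n))}
    (hφ : φ ∈ IsManifold.maximalAtlas (𝓡 n) ∞ M) {y : EuclideanSpace ℝ (Fin n)}
    (hy : y ∈ φ.target) : ContDiffAt ℝ ∞ (f ∘ φ.symm) y :=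
  ((hf (φ.symm y)).comp y (contMDiffAt_symm_of_mem_maximalAtlas hφ hy)).contDiffAt

theorem surjective_fderiv_comp_chartAt_symm {f : M → EuclideanSpace ℝ (Fin p)}
    (hf : ContMDiff (𝓡 n) (𝓡 p) ∞ f) {x : M} (hx : x ∉ singularLocus n f) :
    Function.Surjective (fderiv ℝ (f ∘ (chartAt (EuclideanSpace ℝ (Fin n)) x).symm)
      (chartAt (EuclideanSpace ℝ (Fin n)) x x)) := by
  have hsurj : Function.Surjective (mfderiv (𝓡 n) (𝓡 p) f x) := not_not.1 hx
  have hd : MDifferentiableAt (𝓡 n) (𝓡 p) f x := (hf x).mdifferentiableAt (by simp)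
  rw [hd.mfderiv, (𝓡 n).range_eq_univ, fderivWithin_univ] at hsurj
  exact hsurj

theorem surjective_fderiv_symm_of_mem_maximalAtlas
    {ψ : OpenPartialHomeomorph (EuclideanSpace ℝ (Fin p)) (EuclideanSpace ℝ (Fin p))}
    (hψ : ψ ∈ IsManifold.maximalAtlas (𝓡 p) ∞ (EuclideanSpace ℝ (Fin p)))
    {y : EuclideanSpace ℝ (Fin p)} (hy : y ∈ ψ.target) :
    Function.Surjective (fderiv ℝ ψ.symm y) := by
  have hdiff : ψ.symm.MDifferentiable (𝓡 p) (𝓡 p) :=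
    ⟨(contMDiffOn_symm_of_mem_maximalAtlas hψ).mdifferentiableOn (by simp),
      (contMDiffOn_of_mem_maximalAtlas hψ).mdifferentiableOn (by simp)⟩
  have hsurj := hdiff.mfderiv_surjective hy
  rwa [mfderiv_eq_fderiv] at hsurj

end Chart

section FoldChart

variable {n p : ℕ} [NeZero p] {M : Type*} [TopologicalSpace M]
  [ChartedSpace (EuclideanSpace ℝ (Fin n)) M]

/-- The smooth charts `φ` of `M` at `x` and `ψ` of `ℝᵖ` at `f x` bring `f` into the normal form of a
definite fold, with `σ = ±1` the sign of its quadratic form. -/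
structure IsDefiniteFoldChart (f : M → EuclideanSpace ℝ (Fin p)) (x : M)
    (φ : OpenPartialHomeomorph M (EuclideanSpace ℝ (Fin n)))
    (ψ : OpenPartialHomeomorph (EuclideanSpace ℝ (Fin p)) (EuclideanSpace ℝ (Fin p)))
    (σ : ℝ) : Prop where
  mem_maximalAtlas : φ ∈ IsManifold.maximalAtlas (𝓡 n) ∞ M
  mem_maximalAtlas_cod : ψ ∈ IsManifold.maximalAtlas (𝓡 p) ∞ (EuclideanSpace ℝ (Fin p))
  sign : σ = 1 ∨ σ = -1
  mem_source : x ∈ φ.source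
  apply_eq_zero : φ x = 0
  apply_map_eq_zero : ψ (f x) = 0
  source_subset : φ.source ⊆ f ⁻¹' ψ.source
  apply_map : ∀ z ∈ φ.source,
    ψ (f z) = foldBase p (φ z) + (σ * foldSq p (φ z)) • foldDir p

theorem IsDefiniteFoldPoint.exists_isDefiniteFoldChart {f : M → EuclideanSpace ℝ (Fin p)} {x : M}
    (hpn : p ≤ n) (h : IsDefiniteFoldPoint n f x) :
    ∃ (φ : OpenPartialHomeomorph M (EuclideanSpace ℝ (Fin n)))
      (ψ : OpenPartialHomeomorph (EuclideanSpace ℝ (Fin p)) (EuclideanSpace ℝ (Fin p))) (σ : ℝ),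
      IsDefiniteFoldChart f x φ ψ σ := by
  obtain ⟨l, hl, hdefinite, φ, hφ, ψ, hψ, hx, hφx, hψx, hsub, hform⟩ := h
  have hp := NeZero.ne p
  have chart_of_sign : ∀ σ : ℝ, (σ = 1 ∨ σ = -1) → (∀ i : Fin n, ∀ a : ℝ,
      (if (i : ℕ) + 1 < p then 0 else if (i : ℕ) + 1 < p + l then a ^ 2 else -a ^ 2) =
        σ * if (i : ℕ) + 1 < p then 0 else a ^ 2) → IsDefiniteFoldChart f x φ ψ σ := by
    refine fun σ hσ hsum => ⟨hφ, hψ, hσ, hx, hφx, hψx, hsub, fun z hz => ?_⟩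
    ext j
    rw [foldBase_add_smul_foldDir_apply]
    split_ifs with hj
    · rw [(hform z hz).2 j hj, foldSq, Finset.mul_sum]
      exact Finset.sum_congr rfl fun i _ => hsum i _
    · have hj' : (j : ℕ) + 1 < p := by omega
      rw [(hform z hz).1 ⟨j, by omega⟩ j rfl hj', foldBase_apply, dif_pos ⟨hj', by omega⟩]
  obtain rfl | rfl : l = n + 1 - p ∨ l = 0 := by omega
  · refine ⟨φ, ψ, 1, chart_of_sign 1 (Or.inl rfl) fun i a => ?_⟩
    rw [if_pos (show (i : ℕ) + 1 < p + (n + 1 - p) by omega), one_mul]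
  · refine ⟨φ, ψ, -1, chart_of_sign (-1) (Or.inr rfl) fun i a => ?_⟩
    by_cases hi : (i : ℕ) + 1 < p <;> simp [hi]

namespace IsDefiniteFoldChart

variable {f : M → EuclideanSpace ℝ (Fin p)} {x : M}
  {φ : OpenPartialHomeomorph M (EuclideanSpace ℝ (Fin n))}
  {ψ : OpenPartialHomeomorph (EuclideanSpace ℝ (Fin p)) (EuclideanSpace ℝ (Fin p))} {σ : ℝ}

theorem zero_mem_target (h : IsDefiniteFoldChart f x φ ψ σ) : 0 ∈ φ.target :=
  h.apply_eq_zero ▸ φ.map_source h.mem_source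

theorem zero_mem_target_cod (h : IsDefiniteFoldChart f x φ ψ σ) : 0 ∈ ψ.target :=
  h.apply_map_eq_zero ▸ ψ.map_source (h.source_subset h.mem_source)

theorem symm_zero (h : IsDefiniteFoldChart f x φ ψ σ) : φ.symm 0 = x := by
  rw [← h.apply_eq_zero, φ.left_inv h.mem_source]

theorem symm_zero_cod (h : IsDefiniteFoldChart f x φ ψ σ) : ψ.symm 0 = f x := by
  rw [← h.apply_map_eq_zero, ψ.left_inv (h.source_subset h.mem_source)]

theorem sign_ne_zero (h : IsDefiniteFoldChart f x φ ψ σ) : σ ≠ 0 := by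
  rcases h.sign with rfl | rfl <;> norm_num

theorem eq_of_map_eq (h : IsDefiniteFoldChart f x φ ψ σ) {z z' : M} (hz : z ∈ φ.source)
    (hz' : z' ∈ φ.source) (hzz' : f z = f z') :
    foldBase p (φ z) = foldBase p (φ z') ∧ foldSq p (φ z) = foldSq p (φ z') := by
  have heq := h.apply_map z hz
  rw [hzz', h.apply_map z' hz'] at heq
  obtain ⟨hbase, hsq⟩ := foldBase_add_inj heq
  exact ⟨hbase.symm, (mul_left_cancel₀ h.sign_ne_zero hsq).symm⟩

theorem eq_of_map_eq_self (h : IsDefiniteFoldChart f x φ ψ σ) {z : M} (hz : z ∈ φ.source)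
    (hzx : f z = f x) : z = x := by
  obtain ⟨hbase, hsq⟩ := h.eq_of_map_eq hz h.mem_source hzx
  rw [h.apply_eq_zero] at hbase hsq
  refine φ.injOn hz h.mem_source ?_
  rw [h.apply_eq_zero]
  exact eq_zero_of_foldBase_of_foldSq (hbase.trans (map_zero _)) (hsq.trans foldSq_zero)

theorem isFoldForm (h : IsDefiniteFoldChart f x φ ψ σ) (hpn : p ≤ n)
    (hf : ContMDiff (𝓡 n) (𝓡 p) ∞ f) :
    IsFoldForm (f ∘ φ.symm) ψ.symm (foldBase p) (fun w => σ * foldSq p w) (foldDir p) where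
  contDiffAt := contDiffAt_infty.1
    (contDiffAt_comp_symm hf h.mem_maximalAtlas h.zero_mem_target) 2
  contDiffAt_cod := contDiffAt_infty.1 (contMDiffAt_symm_of_mem_maximalAtlas
    h.mem_maximalAtlas_cod h.zero_mem_target_cod).contDiffAt 2
  surjective :=
    surjective_fderiv_symm_of_mem_maximalAtlas h.mem_maximalAtlas_cod h.zero_mem_target_cod
  eq_zero w hw hs := eq_zero_of_foldBase_of_foldSq hw
    ((mul_eq_zero.1 hs).resolve_left h.sign_ne_zero)
  exists_add := exists_eq_foldBase_add hpn
  apply_smul w := by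
    filter_upwards [(tendsto_smul_const_nhds_zero w).eventually
      (φ.open_target.mem_nhds h.zero_mem_target)] with t ht
    have hsource := φ.map_target ht
    have hmap := h.apply_map _ hsource
    rw [φ.right_inv ht, map_smul, foldSq_smul, mul_left_comm] at hmap
    rw [Function.comp_apply, ← ψ.left_inv (h.source_subset hsource), hmap, smul_smul]

end IsDefiniteFoldChart

end FoldChart

/-! ### Special generic maps with connected fibres -/

theorem eq_of_map_eq_of_injective_steinMap {X Y : Type*} [TopologicalSpace X] [T1Space X]
    {f : X → Y} (hinj : Function.Injective (steinMap f)) {x z : X}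
    (hiso : ∀ᶠ y in 𝓝 x, f y = f x → y = x) (hz : f z = f x) : z = x := by
  obtain ⟨U, hU_iso, hU, hxU⟩ := eventually_nhds_iff.1 hiso
  have hproj : steinProj f x = steinProj f z := hinj hz.symm
  have hzC : z ∈ connectedComponentIn (f ⁻¹' {f x}) x :=
    (Quotient.exact (s := steinSetoid f) hproj).2
  by_contra hne
  obtain ⟨w, hwC, hwU, hwx⟩ := isPreconnected_connectedComponentIn (F := f ⁻¹' {f x}) (x := x)
    U {x}ᶜ hU isOpen_compl_singleton
    (fun w _ => (eq_or_ne w x).imp (fun h : w = x => h.symm ▸ hxU) fun h : w ≠ x => h)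
    ⟨x, mem_connectedComponentIn rfl, hxU⟩ ⟨z, hzC, hne⟩
  exact hwx (hU_iso w hwU (connectedComponentIn_subset (f ⁻¹' {f x}) x hwC))

section SpecialGeneric

variable {n p : ℕ} {M : Type*} [TopologicalSpace M]
  [ChartedSpace (EuclideanSpace ℝ (Fin n)) M] {f : M → EuclideanSpace ℝ (Fin p)}

theorem range_mem_nhds_of_notMem_singularLocus [IsManifold (𝓡 n) ∞ M]
    (hf : ContMDiff (𝓡 n) (𝓡 p) ∞ f) {x : M} (hx : x ∉ singularLocus n f) :
    Set.range f ∈ 𝓝 (f x) := by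
  set φ := chartAt (EuclideanSpace ℝ (Fin n)) x
  have hxφ : x ∈ φ.source := mem_chart_source _ x
  have hstrict := (contDiffAt_comp_symm hf (IsManifold.chart_mem_maximalAtlas x)
    (φ.map_source hxφ)).hasStrictFDerivAt (by simp)
  have hmap := hstrict.map_nhds_eq_of_surj
    (LinearMap.range_eq_top.2 (surjective_fderiv_comp_chartAt_symm hf hx))
  rw [Function.comp_apply, φ.left_inv hxφ] at hmap
  rw [← hmap]
  exact Filter.mem_map.2 (Filter.univ_mem' fun y => ⟨_, rfl⟩)

namespace IsDefiniteFoldChart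

variable [NeZero p] {x : M} {φ : OpenPartialHomeomorph M (EuclideanSpace ℝ (Fin n))}
  {ψ : OpenPartialHomeomorph (EuclideanSpace ℝ (Fin p)) (EuclideanSpace ℝ (Fin p))} {σ : ℝ}

theorem eq_of_injective_steinMap [T1Space M] (h : IsDefiniteFoldChart f x φ ψ σ)
    (hinj : Function.Injective (steinMap f)) {z : M} (hz : f z = f x) : z = x := by
  refine eq_of_map_eq_of_injective_steinMap hinj ?_ hz
  filter_upwards [φ.open_source.mem_nhds h.mem_source] with y hy using h.eq_of_map_eq_self hy

theorem eventually_sign_mul_nonneg [CompactSpace M] (h : IsDefiniteFoldChart f x φ ψ σ)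
    (hf : Continuous f) (hfib : ∀ z, f z = f x → z = x) (hrange : Set.range f ∈ 𝓝 (f x)) :
    ∀ᶠ c : ℝ in 𝓝 0, 0 ≤ σ * c := by
  have hpre : φ.source ∈ Filter.comap f (𝓝 (f x)) := by
    rw [hf.isClosedMap.comap_nhds_eq hf]
    exact φ.open_source.mem_nhdsSet.2 fun z hz => hfib z hz ▸ h.mem_source
  obtain ⟨V, hV, hVφ⟩ := Filter.mem_comap.1 hpre
  have htendsto : Filter.Tendsto (fun c : ℝ => c • foldDir p) (𝓝 0) (𝓝 0) :=
    tendsto_smul_const_nhds_zero _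
  have hcurve : Filter.Tendsto (fun c : ℝ => ψ.symm (c • foldDir p)) (𝓝 0) (𝓝 (f x)) := by
    rw [← h.symm_zero_cod]
    exact (ψ.continuousAt_symm h.zero_mem_target_cod).tendsto.comp htendsto
  filter_upwards [hcurve (Filter.inter_mem hV hrange),
    htendsto (ψ.open_target.mem_nhds h.zero_mem_target_cod)] with c ⟨hcV, z, hz⟩ hcψ
  have hform : foldBase p (0 : EuclideanSpace ℝ (Fin n)) + c • foldDir p =
      foldBase p (φ z) + (σ * foldSq p (φ z)) • foldDir p := by
    rw [← h.apply_map z (hVφ (show f z ∈ V from hz ▸ hcV)), hz, map_zero, zero_add]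
    exact (ψ.right_inv hcψ).symm
  rw [(foldBase_add_inj hform).2, ← mul_assoc]
  exact mul_nonneg (mul_self_nonneg σ) (foldSq_nonneg _)

theorem range_notMem_nhds [CompactSpace M] (h : IsDefiniteFoldChart f x φ ψ σ)
    (hf : Continuous f) (hfib : ∀ z, f z = f x → z = x) : Set.range f ∉ 𝓝 (f x) := by
  intro hrange
  have hnonneg := h.eventually_sign_mul_nonneg hf hfib hrange
  rcases h.sign with rfl | rfl
  · obtain ⟨c, hc, hc'⟩ := hnonneg.exists_lt
    linarith
  · obtain ⟨c, hc, hc'⟩ := hnonneg.exists_gt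
    linarith

theorem dim_ne_of_injective_steinMap [T1Space M] (h : IsDefiniteFoldChart f x φ ψ σ)
    (hinj : Function.Injective (steinMap f)) : p ≠ n := by
  rintro rfl
  have hev : ∀ᶠ c : ℝ in 𝓝 0, c • foldDir p ∈ φ.target :=
    (tendsto_smul_const_nhds_zero _).eventually (φ.open_target.mem_nhds h.zero_mem_target)
  have hev_neg : ∀ᶠ c : ℝ in 𝓝 0, (-c) • foldDir p ∈ φ.target :=
    (Continuous.tendsto' continuous_neg (0 : ℝ) 0 neg_zero).eventually hev
  obtain ⟨t, ht, hpos, hneg⟩ := (hev.and hev_neg).exists_gt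
  have hfold : ∀ c : ℝ, c • foldDir p ∈ φ.target →
      ψ (f (φ.symm (c • foldDir p))) = (σ * c ^ 2) • foldDir p := fun c hc => by
    rw [h.apply_map _ (φ.map_target hc), φ.right_inv hc, map_smul, foldBase_foldDir, smul_zero,
      zero_add, foldSq_smul, foldSq_foldDir, mul_one]
  have hmap : f (φ.symm ((-t) • foldDir p)) = f (φ.symm (t • foldDir p)) := by
    refine ψ.injOn (h.source_subset (φ.map_target hneg)) (h.source_subset (φ.map_target hpos)) ?_
    rw [hfold _ hneg, hfold _ hpos, neg_sq]
  have hne : φ.symm ((-t) • foldDir p) ≠ φ.symm (t • foldDir p) := fun heq => by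
    have hsmul := φ.symm.injOn hneg hpos heq
    have ht_eq : -t = t := smul_left_injective ℝ foldDir_ne_zero hsmul
    linarith
  refine hne (eq_of_map_eq_of_injective_steinMap hinj ?_ hmap)
  filter_upwards [φ.open_source.mem_nhds (φ.map_target hpos),
    isOpen_compl_singleton.mem_nhds hne.symm] with z hz hz_ne hfz
  obtain ⟨hbase, hsq⟩ := h.eq_of_map_eq hz (φ.map_target hpos) hfz
  rw [φ.right_inv hpos, map_smul, foldBase_foldDir, smul_zero] at hbase
  rw [φ.right_inv hpos, foldSq_smul, foldSq_foldDir, mul_one] at hsq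
  rcases eq_smul_foldDir_or_eq_neg_smul_foldDir hbase hsq with hz' | hz'
  · rw [← hz', φ.left_inv hz]
  · exact absurd (by rw [← hz', φ.left_inv hz]; rfl) hz_ne

theorem isLocalMax_norm_comp_symm (h : IsDefiniteFoldChart f x φ ψ σ)
    (hmax : IsLocalMax (fun z => ‖f z‖) x) : IsLocalMax (fun y => ‖(f ∘ φ.symm) y‖) 0 := by
  rw [← h.symm_zero] at hmax
  exact hmax.comp_tendsto (φ.continuousAt_symm h.zero_mem_target)

end IsDefiniteFoldChart

theorem hasStrictFDerivAt_inner_comp_symm (hf : ContMDiff (𝓡 n) (𝓡 p) ∞ f)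
    {φ : OpenPartialHomeomorph M (EuclideanSpace ℝ (Fin n))}
    (hφ : φ ∈ IsManifold.maximalAtlas (𝓡 n) ∞ M) {x : M} (hx : x ∈ φ.source)
    (b : EuclideanSpace ℝ (Fin p)) :
    HasStrictFDerivAt ((fun z => (inner ℝ b (f z) : ℝ)) ∘ φ.symm)
      ((innerSL ℝ b).comp (fderiv ℝ (f ∘ φ.symm) (φ x))) (φ x) :=
  (innerSL ℝ b).hasStrictFDerivAt.comp _
    ((contDiffAt_comp_symm hf hφ (φ.map_source hx)).hasStrictFDerivAt (by simp))

theorem isRegularAt_inner_of_notMem_singularLocus [IsManifold (𝓡 n) ∞ M]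
    (hf : ContMDiff (𝓡 n) (𝓡 p) ∞ f) {x : M} (hx : x ∉ singularLocus n f)
    {b : EuclideanSpace ℝ (Fin p)} (hb : b ≠ 0) :
    IsRegularAt (EuclideanSpace ℝ (Fin n)) (fun z => inner ℝ b (f z)) x := by
  refine ⟨_, mem_chart_source _ x, _, fun hzero => hb ?_, hasStrictFDerivAt_inner_comp_symm hf
    (IsManifold.chart_mem_maximalAtlas x) (mem_chart_source _ x) b⟩
  obtain ⟨w, hw⟩ := surjective_fderiv_comp_chartAt_symm hf hx b
  have hinner := congr($hzero w)
  rw [ContinuousLinearMap.comp_apply, hw] at hinner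
  exact inner_self_eq_zero.1 hinner

namespace IsSpecialGeneric

variable [NeZero p] {x : M}

theorem exists_isDefiniteFoldChart (hf : IsSpecialGeneric n f) (hx : x ∈ singularLocus n f) :
    ∃ (φ : OpenPartialHomeomorph M (EuclideanSpace ℝ (Fin n)))
      (ψ : OpenPartialHomeomorph (EuclideanSpace ℝ (Fin p)) (EuclideanSpace ℝ (Fin p))) (σ : ℝ),
      IsDefiniteFoldChart f x φ ψ σ :=
  (hf.2.2.2 x hx).exists_isDefiniteFoldChart hf.2.1

theorem eq_of_mem_singularLocus [T1Space M] (hf : IsSpecialGeneric n f)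
    (hinj : Function.Injective (steinMap f)) (hx : x ∈ singularLocus n f) {z : M}
    (hz : f z = f x) : z = x := by
  obtain ⟨φ, ψ, σ, h⟩ := hf.exists_isDefiniteFoldChart hx
  exact h.eq_of_injective_steinMap hinj hz

theorem dim_lt_of_mem_singularLocus [T1Space M] (hf : IsSpecialGeneric n f)
    (hinj : Function.Injective (steinMap f)) (hx : x ∈ singularLocus n f) : p < n := by
  obtain ⟨φ, ψ, σ, h⟩ := hf.exists_isDefiniteFoldChart hx
  exact lt_of_le_of_ne hf.2.1 (h.dim_ne_of_injective_steinMap hinj)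

theorem singularLocus_eq_preimage_frontier_range [IsManifold (𝓡 n) ∞ M] [CompactSpace M]
    [T1Space M] (hf : IsSpecialGeneric n f) (hinj : Function.Injective (steinMap f)) :
    singularLocus n f = f ⁻¹' frontier (Set.range f) := by
  ext x
  rw [Set.mem_preimage, (isCompact_range hf.2.2.1.continuous).isClosed.frontier_eq, Set.mem_sdiff,
    mem_interior_iff_mem_nhds]
  constructor
  · intro hx
    obtain ⟨φ, ψ, σ, h⟩ := hf.exists_isDefiniteFoldChart hx
    exact ⟨⟨x, rfl⟩, h.range_notMem_nhds hf.2.2.1.continuous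
      fun z hz => h.eq_of_injective_steinMap hinj hz⟩
  · intro hx
    by_contra hreg
    exact hx.2 (range_mem_nhds_of_notMem_singularLocus hf.2.2.1 hreg)

theorem isRegularAt_inner_of_mem_singularLocus (hf : IsSpecialGeneric n f)
    (hx : x ∈ singularLocus n f) (hmax : IsLocalMax (fun z => ‖f z‖) x)
    {b : EuclideanSpace ℝ (Fin p)} (hb : ‖f x‖ = ‖b‖) (hne : f x ≠ b) (hne_neg : f x ≠ -b) :
    IsRegularAt (EuclideanSpace ℝ (Fin n)) (fun z => inner ℝ b (f z)) x := by
  obtain ⟨φ, ψ, σ, h⟩ := hf.exists_isDefiniteFoldChart hx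
  refine ⟨φ, h.mem_source, _, fun hzero => ?_,
    hasStrictFDerivAt_inner_comp_symm hf.2.2.1 h.mem_maximalAtlas h.mem_source b⟩
  have hfold := h.isFoldForm hf.2.1 hf.2.2.1
  have hnormal := inner_fderiv_eq_zero_of_isLocalMax_norm
    (hfold.contDiffAt.differentiableAt two_ne_zero) (h.isLocalMax_norm_comp_symm hmax)
  rw [Function.comp_apply, h.symm_zero] at hnormal
  rw [h.apply_eq_zero] at hzero
  exact (hfold.eq_or_eq_neg hb hnormal fun w => congr($hzero w)).elim hne hne_neg

theorem hasRadialMaxAt_inner (hf : IsSpecialGeneric n f) (hx : x ∈ singularLocus n f)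
    (hfx : f x ≠ 0) (hmax : IsLocalMax (fun z => ‖f z‖) x) :
    HasRadialMaxAt (EuclideanSpace ℝ (Fin n)) (fun z => inner ℝ (f x) (f z)) x := by
  obtain ⟨φ, ψ, σ, h⟩ := hf.exists_isDefiniteFoldChart hx
  have hFx : (f ∘ φ.symm) 0 = f x := congrArg f h.symm_zero
  have hradial := (h.isFoldForm hf.2.1 hf.2.2.1).isStrictRadialMax_inner (by rwa [hFx])
    (h.isLocalMax_norm_comp_symm hmax)
  rw [hFx] at hradial
  exact ⟨φ, h.mem_source, h.apply_eq_zero, hradial⟩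

end IsSpecialGeneric

end SpecialGeneric

/-! ### Special generic maps onto the ball -/

theorem inner_lt_norm_sq_of_norm_le {V : Type*} [NormedAddCommGroup V] [InnerProductSpace ℝ V]
    {a y : V} (hle : ‖y‖ ≤ ‖a‖) (hne : y ≠ a) : (inner ℝ a y : ℝ) < ‖a‖ ^ 2 := by
  have hpos : 0 < ‖a - y‖ ^ 2 := by
    have := norm_pos_iff.2 (sub_ne_zero.2 hne.symm)
    positivity
  have hsq : ‖y‖ ^ 2 ≤ ‖a‖ ^ 2 := pow_le_pow_left₀ (norm_nonneg y) hle 2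
  rw [norm_sub_sq_real] at hpos
  linarith

theorem norm_le_of_range_eq_closedBall {X V : Type*} [SeminormedAddCommGroup V] {f : X → V} {r : ℝ}
    (himage : Set.range f = Metric.closedBall 0 r) (x : X) : ‖f x‖ ≤ r :=
  mem_closedBall_zero_iff.1 (himage ▸ Set.mem_range_self x)

theorem isLocalMax_norm_of_range_eq_closedBall {X V : Type*} [TopologicalSpace X]
    [SeminormedAddCommGroup V] {f : X → V} {r : ℝ}
    (himage : Set.range f = Metric.closedBall 0 r) {x : X} (hx : ‖f x‖ = r) :
    IsLocalMax (fun z => ‖f z‖) x :=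
  Filter.Eventually.of_forall fun z => (norm_le_of_range_eq_closedBall himage z).trans_eq hx.symm

namespace IsSpecialGeneric

variable {n p : ℕ} [NeZero p] {M : Type*} [TopologicalSpace M] [CompactSpace M]
  [ChartedSpace (EuclideanSpace ℝ (Fin n)) M] [IsManifold (𝓡 n) ∞ M]
  {f : M → EuclideanSpace ℝ (Fin p)}

theorem singularLocus_eq_preimage_sphere [T1Space M] (hf : IsSpecialGeneric n f)
    (himage : Set.range f = Metric.closedBall 0 1) (hinj : Function.Injective (steinMap f)) :
    singularLocus n f = f ⁻¹' Metric.sphere 0 1 := by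
  rw [hf.singularLocus_eq_preimage_frontier_range hinj, himage, frontier_closedBall _ one_ne_zero]

theorem mem_singularLocus_iff [T1Space M] (hf : IsSpecialGeneric n f)
    (himage : Set.range f = Metric.closedBall 0 1) (hinj : Function.Injective (steinMap f))
    {x : M} : x ∈ singularLocus n f ↔ ‖f x‖ = 1 := by
  rw [hf.singularLocus_eq_preimage_sphere himage hinj, Set.mem_preimage, mem_sphere_zero_iff_norm]

theorem dim_lt [T1Space M] (hf : IsSpecialGeneric n f)
    (himage : Set.range f = Metric.closedBall 0 1) (hinj : Function.Injective (steinMap f)) :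
    p < n := by
  obtain ⟨b, hb⟩ := exists_norm_eq (EuclideanSpace ℝ (Fin p)) zero_le_one
  obtain ⟨x, rfl⟩ : b ∈ Set.range f := himage ▸ mem_closedBall_zero_iff.2 hb.le
  exact hf.dim_lt_of_mem_singularLocus hinj ((hf.mem_singularLocus_iff himage hinj).2 hb)

theorem isRegularAt_inner_of_ne_of_ne_neg [T1Space M] (hf : IsSpecialGeneric n f)
    (himage : Set.range f = Metric.closedBall 0 1) (hinj : Function.Injective (steinMap f))
    {b : EuclideanSpace ℝ (Fin p)} (hb : ‖b‖ = 1) {x : M} (hne : f x ≠ b) (hne_neg : f x ≠ -b) :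
    IsRegularAt (EuclideanSpace ℝ (Fin n)) (fun z => inner ℝ b (f z)) x := by
  by_cases hx : x ∈ singularLocus n f
  · have hnorm := (hf.mem_singularLocus_iff himage hinj).1 hx
    exact hf.isRegularAt_inner_of_mem_singularLocus hx
      (isLocalMax_norm_of_range_eq_closedBall himage hnorm) (hnorm.trans hb.symm) hne hne_neg
  · exact isRegularAt_inner_of_notMem_singularLocus hf.2.2.1 hx
      (norm_ne_zero_iff.1 (hb ▸ one_ne_zero))

theorem nonempty_homeomorph_sphere [T2Space M] (hf : IsSpecialGeneric n f)
    (himage : Set.range f = Metric.closedBall 0 1) (hinj : Function.Injective (steinMap f)) :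
    Nonempty (M ≃ₜ Metric.sphere (0 : EuclideanSpace ℝ (Fin (n + 1))) 1) := by
  have hradial : ∀ x, ‖f x‖ = 1 →
      HasRadialMaxAt (EuclideanSpace ℝ (Fin n)) (fun z => inner ℝ (f x) (f z)) x := fun x hx =>
    hf.hasRadialMaxAt_inner ((hf.mem_singularLocus_iff himage hinj).2 hx)
      (norm_ne_zero_iff.1 (hx ▸ one_ne_zero)) (isLocalMax_norm_of_range_eq_closedBall himage hx)
  have hfib : ∀ x, ‖f x‖ = 1 → ∀ z, f z = f x → z = x := fun x hx z =>
    hf.eq_of_mem_singularLocus hinj ((hf.mem_singularLocus_iff himage hinj).2 hx)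
  obtain ⟨b, hb⟩ := exists_norm_eq (EuclideanSpace ℝ (Fin p)) zero_le_one
  obtain ⟨xmax, hxmax⟩ : b ∈ Set.range f := himage ▸ mem_closedBall_zero_iff.2 hb.le
  obtain ⟨xmin, hxmin⟩ : -b ∈ Set.range f :=
    himage ▸ mem_closedBall_zero_iff.2 ((norm_neg b).trans hb).le
  have hmax_norm : ‖f xmax‖ = 1 := hxmax ▸ hb
  have hmin_norm : ‖f xmin‖ = 1 := by rw [hxmin, norm_neg, hb]
  refine nonempty_homeomorph_sphere_of_two_critical_points (g := fun x => inner ℝ b (f x))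
    (xmin := xmin) (xmax := xmax) (continuous_const.inner hf.2.2.1.continuous) ?_
    (fun x hx_min hx_max => ?_) (hxmax ▸ hradial xmax hmax_norm) ?_ fun x hx => ?_
  · rintro rfl
    exact ne_neg_of_mem_unit_sphere ℝ ⟨b, mem_sphere_zero_iff_norm.2 hb⟩
      (Subtype.ext (hxmax.symm.trans hxmin))
  · exact hf.isRegularAt_inner_of_ne_of_ne_neg himage hinj hb
      (fun h => hx_max (hfib xmax hmax_norm x (h.trans hxmax.symm)))
      (fun h => hx_min (hfib xmin hmin_norm x (h.trans hxmin.symm)))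
  · have hneg : (-fun x => (inner ℝ b (f x) : ℝ)) = fun x => inner ℝ (f xmin) (f x) := by
      funext x
      rw [hxmin, inner_neg_left, Pi.neg_apply]
    exact hneg ▸ hradial xmin hmin_norm
  · have hlt := inner_lt_norm_sq_of_norm_le
      ((norm_le_of_range_eq_closedBall himage x).trans_eq hmin_norm.symm)
      (fun h => hx (hfib xmin hmin_norm x h))
    rw [← real_inner_self_eq_norm_sq, hxmin, inner_neg_left, inner_neg_left] at hlt
    simpa only [hxmin, neg_lt_neg_iff] using hlt

end IsSpecialGeneric

/-! ### Transport of a manifold structure along a homeomorphism -/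

section Transport

variable {𝕜 E H M N : Type*} [NontriviallyNormedField 𝕜] [NormedAddCommGroup E] [NormedSpace 𝕜 E]
  [TopologicalSpace H] {I : ModelWithCorners 𝕜 E H} {k : ℕ∞ω} [TopologicalSpace M]
  [TopologicalSpace N] [ChartedSpace H N]

theorem exists_chartAt_eqOn_comp_symm (e : N ≃ₜ M) {c : OpenPartialHomeomorph M H}
    (hc : c ∈ (e.chartedSpace (H := H)).atlas) :
    ∃ y, c.symm = e ∘ (chartAt H y).symm ∧ Set.MapsTo e.symm c.source (chartAt H y).source ∧
      Set.EqOn c (chartAt H y ∘ e.symm) c.source := by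
  obtain ⟨q, rfl⟩ := hc
  set y := e.surjective.hasRightInverse.choose q
  have hsymm : ∀ z ∈ (e.isLocalHomeomorph.localInverseAt y).source,
      e.isLocalHomeomorph.localInverseAt y z = e.symm z := fun z hz =>
    e.injective
      ((e.isLocalHomeomorph.apply_localInverseAt_of_mem hz).trans (e.apply_symm_apply z).symm)
  refine ⟨y, ?_, fun z hz => hsymm z hz.1 ▸ hz.2, fun z hz => congrArg _ (hsymm z hz.1)⟩
  rw [OpenPartialHomeomorph.coe_trans_symm, IsLocalHomeomorph.localInverseAt_symm]

variable [IsManifold I k N] (e : N ≃ₜ M)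

theorem isManifold_homeomorph_chartedSpace :
    letI := e.chartedSpace (H := H); IsManifold I k M := by
  let _ := e.chartedSpace (H := H)
  refine isManifold_of_contDiffOn I k M fun c c' hc hc' => ?_
  obtain ⟨y, hsymm, hsource, happly⟩ := exists_chartAt_eqOn_comp_symm e hc
  obtain ⟨y', -, hsource', happly'⟩ := exists_chartAt_eqOn_comp_symm e hc'
  have htransition := HasGroupoid.compatible (G := contDiffGroupoid k I)
    (chart_mem_atlas H y) (chart_mem_atlas H y')
  rw [contDiffGroupoid, mem_groupoid_of_pregroupoid] at htransition
  have he_symm : ∀ z, e.symm (c.symm z) = (chartAt H y).symm z := fun z => by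
    rw [hsymm, Function.comp_apply, e.symm_apply_apply]
  refine htransition.1.congr_mono ?_ ?_
  · rintro z ⟨⟨-, hz⟩, -⟩
    exact congrArg I ((happly' hz).trans (congrArg _ (he_symm _)))
  · rintro z ⟨⟨hz, hz'⟩, hzI⟩
    have htarget : I.symm z ∈ (chartAt H y).target := by
      rw [← c.right_inv hz, happly (c.map_target hz)]
      exact (chartAt H y).map_source (hsource (c.map_target hz))
    have hsource_y' : (chartAt H y).symm (I.symm z) ∈ (chartAt H y').source :=
      he_symm (I.symm z) ▸ hsource' hz'
    exact ⟨⟨htarget, hsource_y'⟩, hzI⟩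

theorem contMDiff_homeomorph_symm :
    letI := e.chartedSpace (H := H); ContMDiff I I k e.symm := by
  let _ := e.chartedSpace (H := H)
  have := isManifold_homeomorph_chartedSpace (I := I) (k := k) e
  intro x
  obtain ⟨y, -, hsource, happly⟩ := exists_chartAt_eqOn_comp_symm e (chart_mem_atlas H x)
  have hy := hsource (mem_chart_source H x)
  have hx : chartAt H x x = chartAt H y (e.symm x) := happly (mem_chart_source H x)
  have hchart := contMDiffAt_of_mem_maximalAtlas (I := I) (n := k)
    (IsManifold.chart_mem_maximalAtlas x) (mem_chart_source H x)
  have hsymm := contMDiffAt_symm_of_mem_maximalAtlas (I := I) (n := k)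
    (IsManifold.chart_mem_maximalAtlas y) ((chartAt H y).map_source hy)
  refine (ContMDiffAt.comp x (hx.symm ▸ hsymm) hchart).congr_of_eventuallyEq ?_
  filter_upwards [(chartAt H x).open_source.mem_nhds (mem_chart_source H x)] with z hz
  rw [Function.comp_apply, happly hz]
  exact ((chartAt H y).left_inv (hsource hz)).symm

theorem contMDiff_homeomorph :
    letI := e.chartedSpace (H := H); ContMDiff I I k e := by
  let _ := e.chartedSpace (H := H)
  have := isManifold_homeomorph_chartedSpace (I := I) (k := k) e
  intro x
  set c := chartAt H (e x)
  obtain ⟨y, -, hsource, happly⟩ := exists_chartAt_eqOn_comp_symm e (chart_mem_atlas H (e x))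
  have happly_map : ∀ z, e z ∈ c.source → c (e z) = chartAt H y z := fun z hz => by
    rw [happly hz, Function.comp_apply, e.symm_apply_apply]
  have hxc : e x ∈ c.source := mem_chart_source H (e x)
  have hchart := contMDiffAt_of_mem_maximalAtlas (I := I) (n := k)
    (IsManifold.chart_mem_maximalAtlas y) (e.symm_apply_apply x ▸ hsource hxc)
  have hsymm := contMDiffAt_symm_of_mem_maximalAtlas (I := I) (n := k)
    (IsManifold.chart_mem_maximalAtlas (e x)) (c.map_source hxc)
  refine (ContMDiffAt.comp x (happly_map x hxc ▸ hsymm) hchart).congr_of_eventuallyEq ?_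
  filter_upwards [e.continuous.continuousAt (c.open_source.mem_nhds hxc)] with z hz
  rw [Function.comp_apply, ← happly_map z hz]
  exact (c.left_inv hz).symm

variable (I k) in
theorem exists_chartedSpace_diffeomorph :
    ∃ _ : ChartedSpace H M, IsManifold I k M ∧ ∃ Φ : Diffeomorph I I M N k, ⇑Φ = e.symm :=
  let _ := e.chartedSpace (H := H)
  ⟨e.chartedSpace, isManifold_homeomorph_chartedSpace e,
    ⟨e.symm.toEquiv, contMDiff_homeomorph_symm e, contMDiff_homeomorph e⟩, rfl⟩

end Transport

theorem isImmersionOfComplement_comp_diffeomorph {𝕜 E H E' H' F M N P : Type*}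
    [NontriviallyNormedField 𝕜] [NormedAddCommGroup E] [NormedSpace 𝕜 E] [TopologicalSpace H]
    {I : ModelWithCorners 𝕜 E H} [NormedAddCommGroup E'] [NormedSpace 𝕜 E'] [TopologicalSpace H']
    {J : ModelWithCorners 𝕜 E' H'} [NormedAddCommGroup F] [NormedSpace 𝕜 F] {k : ℕ∞ω}
    [TopologicalSpace M] [ChartedSpace H M] [IsManifold I k M] [TopologicalSpace N]
    [ChartedSpace H N] [TopologicalSpace P] [ChartedSpace H' P] {i : N → P}
    (hi : Manifold.IsImmersionOfComplement F I J k i) (Φ : Diffeomorph I I M N k) :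
    Manifold.IsImmersionOfComplement F I J k (i ∘ Φ) := by
  intro x
  have hx := hi (Φ x)
  set c := Φ.toHomeomorph.toOpenPartialHomeomorph.trans hx.domChart
  have hc_source : c.source = Φ ⁻¹' hx.domChart.source := Set.univ_inter _
  have hc_target : c.target = hx.domChart.target := Set.inter_univ _
  refine .mk_of_charts hx.equiv c hx.codChart (hc_source ▸ hx.mem_domChart_source)
    hx.mem_codChart_source ?_ hx.codChart_mem_maximalAtlas
    (fun z hz => hx.source_subset_preimage_source (hc_source.subset hz)) fun y hy => ?_
  · refine OpenPartialHomeomorph.mem_maximalAtlas_of_contMDiffOn _ ?_ ?_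
    · exact (contMDiffOn_of_mem_maximalAtlas hx.domChart_mem_maximalAtlas).comp
        Φ.contMDiff.contMDiffOn hc_source.subset
    · exact Φ.symm.contMDiff.comp_contMDiffOn
        ((contMDiffOn_symm_of_mem_maximalAtlas hx.domChart_mem_maximalAtlas).mono hc_target.subset)
  · have hy' : y ∈ (hx.domChart.extend I).target := by
      rw [OpenPartialHomeomorph.extend_target] at hy ⊢
      exact hc_target ▸ hy
    rw [← hx.writtenInCharts hy']
    exact congrArg (hx.codChart.extend J ∘ i) (Φ.apply_symm_apply _)

theorem isImmersionAtOfComplement_of_charts_eq {𝕜 E H M P : Type*} [NontriviallyNormedField 𝕜]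
    [NormedAddCommGroup E] [NormedSpace 𝕜 E] [TopologicalSpace H] {I : ModelWithCorners 𝕜 E H}
    {k : ℕ∞ω} [TopologicalSpace M] [ChartedSpace H M] [TopologicalSpace P] [ChartedSpace E P]
    {i : M → P} {c : OpenPartialHomeomorph M H} {d : OpenPartialHomeomorph P E}
    (hc : c ∈ IsManifold.maximalAtlas I k M) (hd : d ∈ IsManifold.maximalAtlas 𝓘(𝕜, E) k P)
    (hsource : Set.MapsTo i c.source d.source) (heq : ∀ z ∈ c.source, d (i z) = I (c z))
    {x : M} (hx : x ∈ c.source) :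
    Manifold.IsImmersionAtOfComplement PUnit.{1} I 𝓘(𝕜, E) k i x := by
  refine .mk_of_charts (.prodUnique 𝕜 _ _) c d hx (hsource hx) hc hd hsource fun y hy => ?_
  have hsymm : (c.extend I).symm y ∈ c.source := by
    rw [← c.extend_source (I := I)]
    exact (c.extend I).map_target hy
  exact (heq _ hsymm).trans ((c.extend I).right_inv hy)

theorem isBoundaryPoint_iff_chartAt_apply_zero_eq_zero {p : ℕ} [NeZero p] {M : Type*}
    [TopologicalSpace M] [ChartedSpace (EuclideanHalfSpace p) M] {x : M} :
    (𝓡∂ p).IsBoundaryPoint x ↔ (chartAt (EuclideanHalfSpace p) x x).1 0 = 0 := by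
  rw [ModelWithCorners.isBoundaryPoint_iff, frontier_range_modelWithCornersEuclideanHalfSpace,
    Set.mem_ofPred_eq, eq_comm]
  rfl

/-! ### The closed ball in Euclidean space -/

namespace ClosedDisk

variable {p : ℕ} [NeZero p]

/-- The inversion `cayley` as a chart of the ambient Euclidean space; it extends `chartPos`. -/
noncomputable def cayleyChart (p : ℕ) [NeZero p] :
    OpenPartialHomeomorph (EuclideanSpace ℝ (Fin p)) (EuclideanSpace ℝ (Fin p)) where
  toFun := cayley
  invFun := cayley
  source := {x | x + pole p ≠ 0}
  target := {x | x + pole p ≠ 0}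
  map_source' := cayley_add_pole_ne
  map_target' := cayley_add_pole_ne
  left_inv' := cayley_cayley
  right_inv' := cayley_cayley
  open_source := isOpen_ne_fun (by fun_prop) continuous_const
  open_target := isOpen_ne_fun (by fun_prop) continuous_const
  continuousOn_toFun := contDiffOn_cayley.continuousOn
  continuousOn_invFun := contDiffOn_cayley.continuousOn

/-- The inversion after the antipodal map, as a chart of the ambient Euclidean space; it extends
`chartNeg`. -/
noncomputable def cayleyNegChart (p : ℕ) [NeZero p] :
    OpenPartialHomeomorph (EuclideanSpace ℝ (Fin p)) (EuclideanSpace ℝ (Fin p)) :=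
  (Homeomorph.neg (EuclideanSpace ℝ (Fin p))).toOpenPartialHomeomorph.trans (cayleyChart p)

theorem cayleyChart_mem_maximalAtlas :
    cayleyChart p ∈ IsManifold.maximalAtlas (𝓡 p) ∞ (EuclideanSpace ℝ (Fin p)) :=
  OpenPartialHomeomorph.mem_maximalAtlas_of_contMDiffOn _ contDiffOn_cayley.contMDiffOn
    contDiffOn_cayley.contMDiffOn

theorem cayleyNegChart_mem_maximalAtlas :
    cayleyNegChart p ∈ IsManifold.maximalAtlas (𝓡 p) ∞ (EuclideanSpace ℝ (Fin p)) :=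
  OpenPartialHomeomorph.mem_maximalAtlas_of_contMDiffOn _
    (contDiffOn_cayley.comp contDiff_neg.contDiffOn fun _ hz => hz.2).contMDiffOn
    (contDiff_neg.comp_contDiffOn (contDiffOn_cayley.mono fun _ hz => hz.1)).contMDiffOn

theorem chartPos_mem_atlas : chartPos p ∈ atlas (EuclideanHalfSpace p)
    (Metric.closedBall (0 : EuclideanSpace ℝ (Fin p)) 1) := Or.inl rfl

theorem chartNeg_mem_atlas : chartNeg p ∈ atlas (EuclideanHalfSpace p)
    (Metric.closedBall (0 : EuclideanSpace ℝ (Fin p)) 1) := Or.inr rfl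

theorem antipode_mem_chartPos_source {x : Metric.closedBall (0 : EuclideanSpace ℝ (Fin p)) 1}
    (hx : x ∈ (chartNeg p).source) : antipode p x ∈ (chartPos p).source := hx.2

theorem isImmersionOfComplement_subtypeVal :
    Manifold.IsImmersionOfComplement PUnit.{1} (𝓡∂ p) (𝓡 p) ∞
      (Subtype.val : Metric.closedBall (0 : EuclideanSpace ℝ (Fin p)) 1 → _) := by
  intro x
  by_cases hx : x ∈ (chartPos p).source
  · exact isImmersionAtOfComplement_of_charts_eq (I := 𝓡∂ p)
      (IsManifold.subset_maximalAtlas chartPos_mem_atlas) cayleyChart_mem_maximalAtlas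
      (fun _ hz => hz) (fun z hz => (chartPos_apply z hz).symm) hx
  · exact isImmersionAtOfComplement_of_charts_eq (I := 𝓡∂ p)
      (IsManifold.subset_maximalAtlas chartNeg_mem_atlas) cayleyNegChart_mem_maximalAtlas
      (fun _ hz => ⟨Set.mem_univ _, antipode_mem_chartPos_source hz⟩)
      (fun z hz => (chartPos_apply _ (antipode_mem_chartPos_source hz)).symm)
      (mem_chartNeg_source x hx)

theorem chartPos_apply_zero_eq_zero_iff {x : Metric.closedBall (0 : EuclideanSpace ℝ (Fin p)) 1}
    (hx : x ∈ (chartPos p).source) : (chartPos p x).1 0 = 0 ↔ ‖x.1‖ = 1 := by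
  have hdenom : ‖x.1 + pole p‖ ^ 2 ≠ 0 := pow_ne_zero 2 (norm_ne_zero_iff.2 hx)
  rw [chartPos_apply x hx, cayley_apply_zero x.1 hx, div_eq_zero_iff, or_iff_left hdenom,
    sub_eq_zero, eq_comm, pow_eq_one_iff_of_nonneg (norm_nonneg _) two_ne_zero]

theorem boundary_closedBall :
    (𝓡∂ p).boundary (Metric.closedBall (0 : EuclideanSpace ℝ (Fin p)) 1) =
      Subtype.val ⁻¹' Metric.sphere 0 1 := by
  ext x
  rw [Set.mem_preimage, mem_sphere_zero_iff_norm]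
  refine isBoundaryPoint_iff_chartAt_apply_zero_eq_zero.trans ?_
  by_cases hx : x ∈ (chartPos p).source
  · have hchart : chartAt (EuclideanHalfSpace p) x = chartPos p := if_pos hx
    rw [hchart]
    exact chartPos_apply_zero_eq_zero_iff hx
  · have hchart : chartAt (EuclideanHalfSpace p) x = chartNeg p := if_neg hx
    have hantipode := antipode_mem_chartPos_source (mem_chartNeg_source x hx)
    have hnorm : ‖(antipode p x).1‖ = ‖x.1‖ := norm_neg x.1
    have happly : chartNeg p x = chartPos p (antipode p x) := rfl
    rw [hchart, happly, ← hnorm]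
    exact chartPos_apply_zero_eq_zero_iff hantipode

end ClosedDisk

/-! ### The Stein factorization -/

theorem exists_steinSpace_homeomorph {X Y : Type*} [TopologicalSpace X] [CompactSpace X]
    [TopologicalSpace Y] [T2Space Y] {f : X → Y} {s : Set Y} (hf : Continuous f)
    (himage : Set.range f = s) (hinj : Function.Injective (steinMap f)) :
    ∃ e : SteinSpace f ≃ₜ s, Subtype.val ∘ e = steinMap f := by
  subst himage
  have hcont : Continuous (steinMap f) := hf.quotient_lift _
  have hrange : Set.range (steinMap f) = Set.range f :=
    Set.range_quotient_lift (s := steinSetoid f) _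
  let e := (hcont.isClosedEmbedding hinj).toHomeomorph
  exact ⟨e.trans (Homeomorph.setCongr hrange), rfl⟩

section SteinBall

variable {n p : ℕ} [NeZero p] {M : Type*} [TopologicalSpace M]
  [ChartedSpace (EuclideanSpace ℝ (Fin n)) M] {f : M → EuclideanSpace ℝ (Fin p)}

theorem IsSteinStructure.nonempty_diffeomorph
    {cs : ChartedSpace (EuclideanHalfSpace p) (SteinSpace f)} (hcs : IsSteinStructure n f cs)
    (e : SteinSpace f ≃ₜ Metric.closedBall (0 : EuclideanSpace ℝ (Fin p)) 1)
    (he : Subtype.val ∘ e = steinMap f) :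
    Nonempty (Diffeomorph (𝓡∂ p) (𝓡∂ p) (SteinSpace f)
      (Metric.closedBall (0 : EuclideanSpace ℝ (Fin p)) 1) ∞) := by
  have := hcs.isManifold
  have himm := ClosedDisk.isImmersionOfComplement_subtypeVal (p := p)
  have he_symm : steinMap f ∘ e.symm = Subtype.val := by
    rw [← he, Function.comp_assoc, e.self_comp_symm, Function.comp_id]
  exact ⟨⟨e.toEquiv,
    (ContMDiff.iff_comp_isImmersionOfComplement himm).2
      ⟨e.continuous, he ▸ hcs.immersion_map.contMDiff⟩,
    (ContMDiff.iff_comp_isImmersion hcs.immersion_map).2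
      ⟨e.symm.continuous, he_symm ▸ himm.contMDiff⟩⟩⟩

theorem isSteinStructure_of_diffeomorph (hf : ContMDiff (𝓡 n) (𝓡 p) ∞ f)
    (hsing : singularLocus n f = f ⁻¹' Metric.sphere 0 1)
    {cs : ChartedSpace (EuclideanHalfSpace p) (SteinSpace f)}
    (hcs : IsManifold (𝓡∂ p) ∞ (SteinSpace f))
    (Φ : Diffeomorph (𝓡∂ p) (𝓡∂ p) (SteinSpace f)
      (Metric.closedBall (0 : EuclideanSpace ℝ (Fin p)) 1) ∞)
    (hΦ : Subtype.val ∘ Φ = steinMap f) : IsSteinStructure n f cs := by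
  have himm : Manifold.IsImmersion (𝓡∂ p) (𝓡 p) ∞ (steinMap f) := hΦ ▸
    (isImmersionOfComplement_comp_diffeomorph ClosedDisk.isImmersionOfComplement_subtypeVal
      Φ).isImmersion
  refine ⟨hcs, Φ.toHomeomorph.isEmbedding.t2Space, Φ.toHomeomorph.secondCountableTopology,
    (ContMDiff.iff_comp_isImmersion himm).2 ⟨continuous_quot_mk, hf⟩, ?_, himm⟩
  rw [← Φ.preimage_boundary (by simp), ClosedDisk.boundary_closedBall, hsing]
  exact congr(($hΦ ∘ steinProj f) ⁻¹' Metric.sphere 0 1)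

theorem exists_isSteinStructure (hf : ContMDiff (𝓡 n) (𝓡 p) ∞ f)
    (hsing : singularLocus n f = f ⁻¹' Metric.sphere 0 1)
    (e : SteinSpace f ≃ₜ Metric.closedBall (0 : EuclideanSpace ℝ (Fin p)) 1)
    (he : Subtype.val ∘ e = steinMap f) :
    ∃ cs : ChartedSpace (EuclideanHalfSpace p) (SteinSpace f), IsSteinStructure n f cs := by
  obtain ⟨cs, hcs, Φ, hΦ⟩ := exists_chartedSpace_diffeomorph (𝓡∂ p) ∞ e.symm
  exact ⟨cs, isSteinStructure_of_diffeomorph hf hsing hcs Φ (hΦ ▸ he)⟩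

end SteinBall

theorem mainTheorem9 {n p : ℕ} [NeZero p] {M : Type*} [TopologicalSpace M] [T2Space M]
    [CompactSpace M] [ConnectedSpace M] [ChartedSpace (EuclideanSpace ℝ (Fin n)) M]
    [IsManifold (𝓡 n) ∞ M] (f : M → EuclideanSpace ℝ (Fin p)) (hf : IsSpecialGeneric n f)
    (himage : Set.range f = Metric.closedBall 0 1)
    (hinj : Function.Injective (steinMap f)) :
    IsHomotopySphere n M ∧ IsStandard n f := by
  obtain ⟨h⟩ := hf.nonempty_homeomorph_sphere himage hinj
  have hsphere : IsHomotopySphere n M :=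
    ⟨inferInstance, inferInstance, inferInstance, ⟨h.toHomotopyEquiv⟩⟩
  have hsmooth := hf.2.2.1
  obtain ⟨e, he⟩ := exists_steinSpace_homeomorph hsmooth.continuous himage hinj
  exact ⟨hsphere, hsphere, hf, hf.dim_lt himage hinj,
    exists_isSteinStructure hsmooth (hf.singularLocus_eq_preimage_sphere himage hinj) e he,
    fun _ hcs => hcs.nonempty_diffeomorph e he⟩
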